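/- All graphs are finite and simple. For an integer $n\ge 1$ define graphs $H_i=H_i^{(n)}$ $(i\ge 0)$, each with two distinguished terminals, as follows. $H_0$ is a single edge, its ends being the terminals. $H_1$ is obtained from the complete bipartite graph $K_{n,n}$ by adding two vertices $s,t$ (the terminals), joining $s$ to each vertex of the left side by $n$ internally disjoint paths of length $n$, and joining $t$ to each vertex of the right side by $n$ internally disjoint paths of length $n$ (all these paths being internally disjoint from each other and from the rest). For $i\ge 1$, $H_{i+1}$ is obtained from $H_1$ by replacing every edge by a copy of $H_i$, the source and the sink of the copy being identified with the ends of the edge nearer to $s$ and to $t$, respectively; the terminals of $H_{i+1}$ are $s$ and $t$. The metric $d_{H_i}$ is the unweighted shortest-path metric. Let $F$ be a family of graphs and $H$ a graph. A dominating embedding of $H$ into a graph metric in $F$ consists of a graph $U\in F$ with nonnegative edge lengths, with shortest-path distance $d_U$ (equal to $\infty$ between different components; unit lengths are a special case), and a map $\Phi:V(H)\to V(U)$ such that $d_U(\Phi(x),\Phi(y))\ge d_H(x,y)$ for all $x,y$. A probability distribution over such pairs $(U,\Phi)$ $\alpha$-approximates the metric of $H$ if $\mathbb{E}\,[d_U(\Phi(x),\Phi(y))]\le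 \alpha\, d_H(x,y)$ for all vertices $x,y$ of $H$. **Theorem.** There are an absolute constant $c>0$ and an absolute integer $k\ge 0$ such that for every $n\ge 1$ the following holds. Every $H_i$ is a finite connected graph of treewidth at most $n+1$, and $|V(H_i)|\to\infty$ as $i\to\infty$. Let $F$ be any minor-closed family of graphs which does not contain some graph $M$ with $|V(M)|=n$. Then for every $i\ge 0$, every $\alpha$ for which some probability distribution over dominating embeddings of $H_i$ into graph metrics in $F$ $\alpha$-approximates the metric of $H_i$ satisfies $$\alpha\;\ge\; \frac{c}{n^{k}}\,\log |V(H_i)| .$$ -/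

import Mathlib

open scoped NNReal ENNReal

/-! ### Minors and minor-closed families of finite graphs -/

/-- A finite simple graph together with its vertex type. -/
structure FinGraph where
  V : Type
  finite : Finite V
  graph : SimpleGraph V

/-- `M` is a minor of `G`: there are pairwise disjoint nonempty connected branch sets in `G`, one
for each vertex of `M`, such that adjacent vertices of `M` have branch sets joined by an edge. -/
def IsGraphMinor {W V : Type*} (M : SimpleGraph W) (G : SimpleGraph V) : Prop :=
  ∃ B : W → Set V,
    (∀ w, (G.induce (B w)).Connected) ∧
    (∀ w w', w ≠ w' → Disjoint (B w) (B w')) ∧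
    ∀ w w', M.Adj w w' → ∃ x ∈ B w, ∃ y ∈ B w', G.Adj x y

/-- A family of finite graphs containing all minors of its members. -/
def MinorClosed (F : Set FinGraph) : Prop :=
  ∀ G ∈ F, ∀ G' : FinGraph, IsGraphMinor G'.graph G.graph → G' ∈ F

/-! ### Treewidth -/

/-- A tree decomposition of `G` over a finite tree. -/
structure TreeDecomposition {V : Type*} (G : SimpleGraph V) where
  I : Type
  finite : Finite I
  tree : SimpleGraph I
  isTree : tree.IsTree
  bag : I → Set V
  cover_vertex : ∀ v, ∃ i, v ∈ bag i
  cover_edge : ∀ u v, G.Adj u v → ∃ i, u ∈ bag i ∧ v ∈ bag i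
  inter_subset : ∀ (i j k : I) (p : tree.Walk i k), p.IsPath → j ∈ p.support →
    bag i ∩ bag k ⊆ bag j

/-- The width: the maximal size of a bag, minus one. -/
noncomputable def TreeDecomposition.width {V : Type*} {G : SimpleGraph V}
    (D : TreeDecomposition G) : ℕ∞ :=
  (⨆ i, (D.bag i).encard) - 1

/-- The treewidth: the minimal width of a tree decomposition. -/
noncomputable def treewidth {V : Type*} (G : SimpleGraph V) : ℕ∞ :=
  ⨅ D : TreeDecomposition G, D.width

/-! ### Distributions over dominating graph metrics -/

/-- The shortest-path distance in `G` with edge lengths `ℓ`; it is `∞` between vertices in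
different components. -/
noncomputable def weightedDist {V : Type*} (G : SimpleGraph V) (ℓ : Sym2 V → ℝ≥0) (u v : V) :
    ℝ≥0∞ :=
  ⨅ p : G.Walk u v, (((p.edges.map ℓ).sum : ℝ≥0) : ℝ≥0∞)

/-- The unweighted shortest-path distance of `H`, as an extended nonnegative real. -/
noncomputable def pathDist {V : Type*} (H : SimpleGraph V) (x y : V) : ℝ≥0∞ :=
  ((H.edist x y : ℕ∞) : ℝ≥0∞)

/-- A graph of the family `F` with nonnegative edge lengths, and a map of the vertices of `H` into
it such that distances in the target dominate distances in `H`. -/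
structure DominatingEmbedding {V : Type*} (F : Set FinGraph) (H : SimpleGraph V) where
  target : FinGraph
  target_mem : target ∈ F
  edgeLength : Sym2 target.V → ℝ≥0
  toFun : V → target.V
  dominates : ∀ x y, pathDist H x y ≤ weightedDist target.graph edgeLength (toFun x) (toFun y)

/-- The distance in the target between the images of `x` and `y`. -/
noncomputable def DominatingEmbedding.dist {V : Type*} {F : Set FinGraph} {H : SimpleGraph V}
    (Φ : DominatingEmbedding F H) (x y : V) : ℝ≥0∞ :=
  weightedDist Φ.target.graph Φ.edgeLength (Φ.toFun x) (Φ.toFun y)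

/-- The random dominating embedding `Φ`, defined on the probability space `(Ω, μ)`,
`α`-approximates the metric of `H`: no distance is stretched by more than `α` in expectation. -/
structure ApproximatesInExpectation {V Ω : Type*} [MeasurableSpace Ω] {F : Set FinGraph}
    {H : SimpleGraph V} (μ : MeasureTheory.Measure Ω) (Φ : Ω → DominatingEmbedding F H)
    (α : ℝ≥0) : Prop where
  aemeasurable : ∀ x y, AEMeasurable (fun ω => (Φ ω).dist x y) μ
  expectation_le : ∀ x y, ∫⁻ ω, (Φ ω).dist x y ∂μ ≤ α * pathDist H x y

/-! ### The recursive construction -/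

/-- A graph with two terminals, a source and a sink. -/
structure TerminalGraph where
  V : Type
  graph : SimpleGraph V
  source : V
  sink : V

/-- The vertices of the base graph: the terminals `s` and `t`, the two sides `left` and `right` of
`K_{n,n}`, and the inner vertices of the paths: `leftInner a j k` is the inner vertex number `k + 1`
of the `j`-th path from `s` to `left a`, and `rightInner b j k` is the inner vertex number `k + 1`
of the `j`-th path from `right b` to `t`. -/
inductive BaseVertex (n : ℕ) : Type
  | s : BaseVertex n
  | t : BaseVertex n
  | left (a : Fin n) : BaseVertex n
  | right (b : Fin n) : BaseVertex n
  | leftInner (a j : Fin n) (k : Fin (n - 1)) : BaseVertex n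
  | rightInner (b j : Fin n) (k : Fin (n - 1)) : BaseVertex n

/-- The vertex at position `k` (from `0` to `n`) of the `j`-th path from `s` to `left a`. -/
def leftPath {n : ℕ} (a j : Fin n) (k : ℕ) : BaseVertex n :=
  if k = 0 then .s else if h : k - 1 < n - 1 then .leftInner a j ⟨k - 1, h⟩ else .left a

/-- The vertex at position `k` (from `0` to `n`) of the `j`-th path from `right b` to `t`. -/
def rightPath {n : ℕ} (b j : Fin n) (k : ℕ) : BaseVertex n :=
  if k = 0 then .right b else if h : k - 1 < n - 1 then .rightInner b j ⟨k - 1, h⟩ else .t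

/-- The edges of the base graph: `leftEdge a j k` is the edge from position `k` to position `k + 1`
of the `j`-th path from `s` to `left a`, `midEdge a b` is the edge of `K_{n,n}` from `left a` to
`right b`, and `rightEdge b j k` is the edge from position `k` to position `k + 1` of the `j`-th
path from `right b` to `t`. -/
inductive BaseEdge (n : ℕ) : Type
  | leftEdge (a j k : Fin n) : BaseEdge n
  | midEdge (a b : Fin n) : BaseEdge n
  | rightEdge (b j k : Fin n) : BaseEdge n

/-- The end of an edge on the side of `s`. -/
def BaseEdge.tail {n : ℕ} : BaseEdge n → BaseVertex n
  | .leftEdge a j k => leftPath a j k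
  | .midEdge a _ => .left a
  | .rightEdge b j k => rightPath b j k

/-- The end of an edge on the side of `t`. -/
def BaseEdge.head {n : ℕ} : BaseEdge n → BaseVertex n
  | .leftEdge a j k => leftPath a j (k + 1)
  | .midEdge _ b => .right b
  | .rightEdge b j k => rightPath b j (k + 1)

/-- The vertices obtained from the base graph by replacing each edge by a copy of `X`: the base
vertices, and for each base edge a copy of the non-terminal vertices of `X`. -/
abbrev ReplacedVertex (n : ℕ) (X : TerminalGraph) : Type :=
  BaseVertex n ⊕ (BaseEdge n × {v : X.V // v ≠ X.source ∧ v ≠ X.sink})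

open Classical in
/-- The copy of the vertex `v` of `X` that replaces the edge `e`: the source and the sink of `X`
are identified with the two ends of `e`. -/
noncomputable def place {n : ℕ} (X : TerminalGraph) (e : BaseEdge n) (v : X.V) :
    ReplacedVertex n X :=
  if hs : v = X.source then .inl e.tail
  else if ht : v = X.sink then .inl e.head
  else .inr (e, ⟨v, hs, ht⟩)

/-- The base graph with each edge replaced by a copy of `X`. -/
noncomputable def replaceEdges (n : ℕ) (X : TerminalGraph) : TerminalGraph where
  V := ReplacedVertex n X
  graph := SimpleGraph.fromRel fun x y =>
    ∃ (e : BaseEdge n) (a b : X.V), X.graph.Adj a b ∧ place X e a = x ∧ place X e b = y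
  source := .inl .s
  sink := .inl .t

/-- The graphs `H_i`: `H_0` is a single edge between its terminals, and `H_{i+1}` is the base graph
with each edge replaced by a copy of `H_i`; so `H_1` is the base graph itself. -/
noncomputable def recGraph (n : ℕ) : ℕ → TerminalGraph
  | 0 => { V := Bool, graph := ⊤, source := false, sink := true }
  | i + 1 => replaceEdges n (recGraph n i)

/-! Write m = n²(2n + 1) for the number of edges of H_1. A graph in F has no complete minor on n
vertices, since M would then be a minor of it. Fix a dominating embedding and a scale l, and let D =
(2n + 1)^l be the distance between the terminals of H_l. Suppose that every copy of H_l in a copy of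
H_{l+1} had a climb from source to sink whose consecutive images are less than D/8 apart. Trace
these climbs in the target by short walks. The walks that start within D/4 of the c-th core (the
copy of H_l on the edge from `left c` to `right c`) form a connected set, and the copy on the edge
from `left a` to `right b` joins the sets of a and b. By domination, two walks can meet only if
their starts are less than D/4 apart in H_{l+1}. This excludes all unwanted intersections and yields
the forbidden minor (`isGraphMinor_top_of_hasClimb`).

So some copy of H_l has no such climb. Since H_1 splits into n² edge-disjoint paths between its
terminals and climbs compose along such a path, recursion gives at least n^(2l) edges in that copy
of stretch at least D/8 (`le_edgeSum_of_not_hasClimb`). There are m^(i-l-1) copies of H_{l+1} in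
H_i. Weighted by (2n + 1)^l, the stretched edges at scale l therefore contribute at least m^(i-1),
whatever l is (`le_edgeSum_stretched`). The scales grow geometrically, so the length of one edge
pays for all its scales at once (`sum_scales_le`), and the i scales together force total length at
least i m^(i-1)/12 on m^i edges (`mul_pow_le_edgeSum`). Taking expectations, α ≥ i/(12m), while log
|V(H_i)| ≤ 1 + 9 i n³.

The treewidth bound comes from hanging a decomposition of each copy below a bag containing both ends
of the edge it replaces: the widths combine by a maximum. -/

/-! ### Walks inside a set, and a criterion for complete minors -/

/-- `u` and `v` are joined by a walk of `G` all of whose vertices lie in `S`. -/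
def JoinedWithin {V : Type*} (G : SimpleGraph V) (S : Set V) (u v : V) : Prop :=
  ∃ p : G.Walk u v, ∀ x ∈ p.support, x ∈ S

namespace JoinedWithin

variable {V : Type*} {G : SimpleGraph V} {S T : Set V} {u v w : V}

theorem refl (h : u ∈ S) : JoinedWithin G S u u := ⟨.nil, by simpa using h⟩

theorem symm (h : JoinedWithin G S u v) : JoinedWithin G S v u := by
  obtain ⟨p, hp⟩ := h
  exact ⟨p.reverse, by simpa using hp⟩

theorem trans (h : JoinedWithin G S u v) (h' : JoinedWithin G S v w) : JoinedWithin G S u w := by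
  obtain ⟨p, hp⟩ := h
  obtain ⟨q, hq⟩ := h'
  refine ⟨p.append q, fun x hx => ?_⟩
  rw [SimpleGraph.Walk.mem_support_append_iff] at hx
  exact hx.elim (hp x) (hq x)

theorem mono (hST : S ⊆ T) (h : JoinedWithin G S u v) : JoinedWithin G T u v := by
  obtain ⟨p, hp⟩ := h
  exact ⟨p, fun x hx => hST (hp x hx)⟩

theorem left_mem (h : JoinedWithin G S u v) : u ∈ S := by
  obtain ⟨p, hp⟩ := h
  exact hp u p.start_mem_support

theorem of_adj (h : G.Adj u v) (hu : u ∈ S) (hv : v ∈ S) : JoinedWithin G S u v :=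
  ⟨.cons h .nil, by simp [hu, hv]⟩

theorem of_mem_support {a b : V} (p : G.Walk a b) (hu : u ∈ p.support) (hv : v ∈ p.support) :
    JoinedWithin G {x | x ∈ p.support} u v := by
  classical
  have key : ∀ {z}, z ∈ p.support → JoinedWithin G {x | x ∈ p.support} a z := fun {z} hz =>
    ⟨p.takeUntil z hz, fun x hx => p.support_takeUntil_subset_support hz hx⟩
  exact (key hu).symm.trans (key hv)

theorem connected (hu : u ∈ S) (h : ∀ v ∈ S, JoinedWithin G S u v) : (G.induce S).Connected := by
  refine G.induce_connected_of_patches u hu fun {v} hv => ?_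
  obtain ⟨p, hp⟩ := h v hv
  exact ⟨{x | x ∈ p.support}, hp, p.start_mem_support, p.end_mem_support,
    p.connected_induce_support _ _⟩

end JoinedWithin

/-- A walk from outside `K` to `K` stays outside `K` until an edge leads into `K`. -/
theorem SimpleGraph.Walk.exists_prefix_avoiding {V : Type*} {G : SimpleGraph V} {K : Set V}
    {u v : V} (p : G.Walk u v) (hu : u ∉ K) (hv : v ∈ K) :
    ∃ (x y : V) (q : G.Walk u x), G.Adj x y ∧ y ∈ K ∧ ∀ z ∈ q.support, z ∈ p.support ∧ z ∉ K := by
  induction p with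
  | nil => exact absurd hv hu
  | @cons a b c h p ih =>
    by_cases hb : b ∈ K
    · exact ⟨a, b, .nil, h, hb, by simp [hu]⟩
    · obtain ⟨x, y, q, hxy, hy, hq⟩ := ih hb hv
      refine ⟨x, y, .cons h q, hxy, hy, fun z hz => ?_⟩
      rw [SimpleGraph.Walk.support_cons, List.mem_cons] at hz ⊢
      rcases hz with rfl | hz
      · exact ⟨.inl rfl, hu⟩
      · exact ⟨.inr (hq z hz).1, (hq z hz).2⟩

/-- Disjoint connected sets, pairwise joined by walks which avoid the other sets and which meet each
other only inside the sets they join, yield a complete minor. -/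
theorem isGraphMinor_top_of_connectors {V W : Type*} [LinearOrder W] {G : SimpleGraph V}
    (K : W → Set V) (base : W → V) (hbase : ∀ w, base w ∈ K w)
    (hconn : ∀ w, ∀ v ∈ K w, JoinedWithin G (K w) (base w) v)
    (hdisj : ∀ w w', w ≠ w' → Disjoint (K w) (K w')) (C : W → W → Set V)
    (hjoin : ∀ w w', w < w' → ∃ v ∈ K w', JoinedWithin G (C w w') (base w) v)
    (havoid : ∀ w w' v, w < w' → v ≠ w → v ≠ w' → Disjoint (C w w') (K v))
    (hmeet : ∀ w w' v v', w < w' → v < v' → (w, w') ≠ (v, v') → C w w' ∩ C v v' ⊆ K w ∪ K w') :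
    IsGraphMinor (⊤ : SimpleGraph W) G := by
  -- Cut each connector just before it first enters the later set; the values for pairs with `w ≥
  -- w'` are dummies.
  have hpre : ∀ w w', ∃ (x y : V) (S : Set V), w < w' → G.Adj x y ∧ y ∈ K w' ∧ x ∈ S ∧
      (∀ z ∈ S, JoinedWithin G S (base w) z) ∧ ∀ z ∈ S, z ∈ C w w' ∧ z ∉ K w' := by
    intro w w'
    by_cases h : w < w'
    · obtain ⟨v, hv, p, hp⟩ := hjoin w w' h
      have hb : base w ∉ K w' := Set.disjoint_left.1 (hdisj w w' h.ne) (hbase w)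
      obtain ⟨x, y, q, hxy, hy, hq⟩ := p.exists_prefix_avoiding hb hv
      exact ⟨x, y, {z | z ∈ q.support}, fun _ => ⟨hxy, hy, q.end_mem_support,
        fun z hz => .of_mem_support _ q.start_mem_support hz,
        fun z hz => ⟨hp z (hq z hz).1, (hq z hz).2⟩⟩⟩
    · exact ⟨base w, base w, ∅, fun h' => absurd h' h⟩
  choose X Y S hS using hpre
  -- Each truncated connector is given to its smaller end, so the branch sets stay disjoint and
  -- touch along the cut edge.
  refine ⟨fun w => K w ∪ {z | ∃ w', w < w' ∧ z ∈ S w w'}, fun w => ?_, ?_, ?_⟩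
  · refine JoinedWithin.connected (.inl (hbase w)) fun v hv => ?_
    rcases hv with hv | ⟨w', hw, hv⟩
    · exact (hconn w v hv).mono Set.subset_union_left
    · exact ((hS w w' hw).2.2.2.1 v hv).mono fun z hz => .inr ⟨w', hw, hz⟩
  · intro w v hne
    have key : ∀ w v, w ≠ v → ∀ w', w < w' → ∀ z ∈ S w w', z ∉ K v := by
      intro w v hne w' hw z hz hzv
      have h1 := (hS w w' hw).2.2.2.2 z hz
      by_cases h : v = w'
      · subst h
        exact h1.2 hzv
      · exact Set.disjoint_left.1 (havoid w w' v hw hne.symm h) h1.1 hzv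
    rw [Set.disjoint_left]
    rintro z (hz | ⟨w', hw, hz⟩) (hz' | ⟨v', hv, hz'⟩)
    · exact Set.disjoint_left.1 (hdisj w v hne) hz hz'
    · exact key v w hne.symm v' hv z hz' hz
    · exact key w v hne w' hw z hz hz'
    · have h1 := (hS w w' hw).2.2.2.2 z hz
      have h2 := (hS v v' hv).2.2.2.2 z hz'
      rcases hmeet w w' v v' hw hv (fun h => hne (Prod.ext_iff.1 h).1) ⟨h1.1, h2.1⟩ with h | h
      · exact key v w hne.symm v' hv z hz' h
      · exact h1.2 h
  · have key : ∀ w w', w < w' → ∃ x ∈ K w ∪ {z | ∃ w', w < w' ∧ z ∈ S w w'},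
        ∃ y ∈ K w' ∪ {z | ∃ v, w' < v ∧ z ∈ S w' v}, G.Adj x y := fun w w' h =>
      ⟨X w w', .inr ⟨w', h, (hS w w' h).2.2.1⟩, Y w w', .inl (hS w w' h).2.1, (hS w w' h).1⟩
    intro w w' h
    rcases lt_or_gt_of_ne h.ne with h | h
    · exact key w w' h
    · obtain ⟨x, hx, y, hy, hxy⟩ := key w' w h
      exact ⟨y, hy, x, hx, hxy.symm⟩

/-- A graph with `n` vertices is a minor of every graph with a complete minor on `n` vertices. -/
theorem IsGraphMinor.of_top {W W' V : Type*} {M : SimpleGraph W'} {G : SimpleGraph V}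
    (h : IsGraphMinor (⊤ : SimpleGraph W) G) (e : W' ≃ W) : IsGraphMinor M G := by
  obtain ⟨B, hB, hd, ha⟩ := h
  exact ⟨fun w => B (e w), fun w => hB _, fun w w' hw => hd _ _ (e.injective.ne hw),
    fun w w' hw => ha _ _ (e.injective.ne hw.ne)⟩

/-! ### Distances -/

/-- A vertex function that grows by at most one along each edge is one-Lipschitz. -/
theorem SimpleGraph.Walk.le_add_length {V : Type*} {H : SimpleGraph V} {f : V → ℕ}
    (hf : ∀ a b, H.Adj a b → f a ≤ f b + 1) {x y : V} (p : H.Walk x y) : f x ≤ f y + p.length := by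
  induction p with
  | nil => simp
  | cons h p ih =>
    have := hf _ _ h
    rw [SimpleGraph.Walk.length_cons]
    omega

/-- A map that sends each edge to an edge or a vertex does not increase distances. -/
theorem pathDist_le_of_collapse {V V' : Type*} {H : SimpleGraph V} {H' : SimpleGraph V'}
    {r : V → V'} (hr : ∀ a b, H.Adj a b → r a = r b ∨ H'.Adj (r a) (r b)) (x y : V) :
    pathDist H' (r x) (r y) ≤ pathDist H x y := by
  have key : ∀ {x y : V} (p : H.Walk x y), ∃ q : H'.Walk (r x) (r y), q.length ≤ p.length := by
    intro x y p
    induction p with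
    | nil => exact ⟨.nil, le_rfl⟩
    | @cons a b c h p ih =>
      obtain ⟨q, hq⟩ := ih
      rcases hr _ _ h with h | h
      · exact ⟨q.copy h.symm rfl, by simp; omega⟩
      · exact ⟨.cons h q, by simpa using hq⟩
  refine ENat.toENNReal_le.2 (le_iInf fun p => ?_)
  obtain ⟨q, hq⟩ := key p
  exact q.edist_le.trans (by exact_mod_cast hq)

theorem exists_walk_of_pathDist_lt {V : Type*} {H : SimpleGraph V} {x y : V} {c : ℝ≥0}
    (h : pathDist H x y < c) : ∃ p : H.Walk x y, (p.length : ℝ≥0) < c := by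
  have hne : H.edist x y ≠ ⊤ := by
    intro h'
    simp [pathDist, h'] at h
  obtain ⟨p, hp⟩ := SimpleGraph.exists_walk_of_edist_ne_top hne
  refine ⟨p, ?_⟩
  rw [pathDist, ← hp, ENat.toENNReal_coe] at h
  exact_mod_cast h

theorem exists_walk_of_weightedDist_lt {V : Type*} {G : SimpleGraph V} {ℓ : Sym2 V → ℝ≥0} {u v : V}
    {c : ℝ≥0} (h : weightedDist G ℓ u v < c) : ∃ p : G.Walk u v, (p.edges.map ℓ).sum < c := by
  obtain ⟨p, hp⟩ := iInf_lt_iff.1 h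
  exact ⟨p, by exact_mod_cast hp⟩

/-- The starts of two intersecting walks are no farther apart than the sum of the lengths. -/
theorem weightedDist_le_of_mem_support {V : Type*} {G : SimpleGraph V} {ℓ : Sym2 V → ℝ≥0}
    {a b a' b' u : V} (p : G.Walk a b) (q : G.Walk a' b') (hp : u ∈ p.support)
    (hq : u ∈ q.support) :
    weightedDist G ℓ a a' ≤ (((p.edges.map ℓ).sum + (q.edges.map ℓ).sum : ℝ≥0) : ℝ≥0∞) := by
  classical
  have key : ∀ {a b : V} (p : G.Walk a b) (hp : u ∈ p.support),
      ((p.takeUntil u hp).edges.map ℓ).sum ≤ (p.edges.map ℓ).sum := by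
    intro a b p hp
    conv_rhs => rw [← p.take_spec hp]
    rw [SimpleGraph.Walk.edges_append, List.map_append, List.sum_append]
    exact le_self_add
  refine (iInf_le _ ((p.takeUntil u hp).append (q.takeUntil u hq).reverse)).trans ?_
  rw [SimpleGraph.Walk.edges_append, List.map_append, List.sum_append,
    SimpleGraph.Walk.edges_reverse, List.map_reverse, List.sum_reverse]
  exact ENNReal.coe_le_coe.2 (add_le_add (key p hp) (key q hq))

/-! ### Rooted tree decompositions -/

/-- A tree decomposition whose tree is given by a parent function. The nodes whose bags contain a
given vertex form a subtree: all of them but one have a parent with this property. -/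
structure RootedDecomposition {V : Type*} (G : SimpleGraph V) where
  I : Type
  finite : Finite I
  root : I
  parent : I → I
  rank : I → ℕ
  rank_lt : ∀ i, i ≠ root → rank (parent i) < rank i
  bag : I → Set V
  cover_vertex : ∀ v, ∃ i, v ∈ bag i
  cover_edge : ∀ u v, G.Adj u v → ∃ i, u ∈ bag i ∧ v ∈ bag i
  top : ∀ v, ∃ τ, ∀ i, v ∈ bag i → i = τ ∨ (i ≠ root ∧ v ∈ bag (parent i))

namespace RootedDecomposition

variable {V : Type*} {G : SimpleGraph V} (D : RootedDecomposition G)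

/-- The tree on the nodes of a rooted decomposition. -/
def tree : SimpleGraph D.I := SimpleGraph.fromRel fun i j => i ≠ D.root ∧ D.parent i = j

theorem adj_parent {i : D.I} (h : i ≠ D.root) : D.tree.Adj i (D.parent i) := by
  rw [tree, SimpleGraph.fromRel_adj]
  exact ⟨fun h' => (D.rank_lt i h).ne (by rw [← h']), .inl ⟨h, rfl⟩⟩

theorem tree_connected : D.tree.Connected := by
  have key : ∀ r i, D.rank i = r → D.tree.Reachable D.root i := by
    intro r
    induction r using Nat.strong_induction_on with
    | _ r ih =>
      intro i hi
      by_cases h : i = D.root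
      · rw [h]
      · exact (ih _ (hi ▸ D.rank_lt i h) _ rfl).trans (D.adj_parent h).symm.reachable
  exact SimpleGraph.connected_iff_exists_forall_reachable _ |>.2 ⟨D.root, fun i => key _ i rfl⟩

/-- A connected graph is a tree once it has at most one edge fewer than vertices, and sending each
non-root node to its parent edge is onto the edges. -/
theorem tree_isTree : D.tree.IsTree := by
  have := D.finite
  rw [SimpleGraph.isTree_iff_connected_and_card]
  refine ⟨D.tree_connected, le_antisymm ?_ D.tree_connected.card_vert_le_card_edgeSet_add_one⟩
  let f : {i : D.I // i ≠ D.root} → D.tree.edgeSet := fun i => ⟨s(i.1, D.parent i), D.adj_parent i.2⟩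
  have hf : Function.Surjective f := by
    rintro ⟨e, he⟩
    induction e using Sym2.ind with
    | _ x y =>
      rw [SimpleGraph.mem_edgeSet, tree, SimpleGraph.fromRel_adj] at he
      rcases he.2 with ⟨hx, rfl⟩ | ⟨hy, rfl⟩
      · exact ⟨⟨x, hx⟩, rfl⟩
      · exact ⟨⟨y, hy⟩, Subtype.ext Sym2.eq_swap⟩
  have h1 := Nat.card_le_card_of_surjective f hf
  have h2 : Nat.card {i : D.I // i ≠ D.root} < Nat.card D.I :=
    Finite.card_subtype_lt (x := D.root) (by simp)
  omega

/-- From either node, passing to parents stays among bags containing `v` until the common topmost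
node is reached. -/
theorem joinedWithin {v : V} {i k : D.I} (hi : v ∈ D.bag i) (hk : v ∈ D.bag k) :
    JoinedWithin D.tree {j | v ∈ D.bag j} i k := by
  obtain ⟨τ, hτ⟩ := D.top v
  have key : ∀ r i, D.rank i = r → v ∈ D.bag i → JoinedWithin D.tree {j | v ∈ D.bag j} i τ := by
    intro r
    induction r using Nat.strong_induction_on with
    | _ r ih =>
      intro i hr hi
      rcases hτ i hi with rfl | ⟨h, hp⟩
      · exact .refl hi
      · exact (JoinedWithin.of_adj (D.adj_parent h) hi hp).trans
          (ih _ (hr ▸ D.rank_lt i h) _ rfl hp)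
  exact (key _ i rfl hi).trans (key _ k rfl hk).symm

/-- The tree decomposition underlying a rooted decomposition. -/
def toTreeDecomposition : TreeDecomposition G where
  I := D.I
  finite := D.finite
  tree := D.tree
  isTree := D.tree_isTree
  bag := D.bag
  cover_vertex := D.cover_vertex
  cover_edge := D.cover_edge
  inter_subset := by
    classical
    rintro i j k p hp hj v ⟨hi, hk⟩
    obtain ⟨q, hq⟩ := D.joinedWithin hi hk
    -- Paths in a tree are unique, so `p` is the shortcut of the walk `q`, all of whose bags contain
    -- `v`.
    have h : (⟨p, hp⟩ : D.tree.Path i k) = q.toPath := (D.tree_isTree.isAcyclic.subsingleton_path _ _).elim _ _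
    have h' : p = q.toPath.1 := congrArg Subtype.val h
    rw [h'] at hj
    exact hq j (q.support_toPath_subset_support hj)

theorem treewidth_le {k : ℕ} (h : ∀ i, (D.bag i).encard ≤ ((k + 1 : ℕ) : ℕ∞)) :
    treewidth G ≤ k := by
  refine (iInf_le _ D.toTreeDecomposition).trans ?_
  refine tsub_le_iff_right.2 (iSup_le fun i => ?_)
  exact_mod_cast h i

end RootedDecomposition

/-! ### The base graph -/

/-- The base edges, sorted into `n²` edge-disjoint paths of `2n + 1` edges from `s` to `t`. -/
def baseEdgeEquiv (n : ℕ) : BaseEdge n ≃ (Fin n × Fin n) × (Fin n ⊕ Unit ⊕ Fin n) where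
  toFun
    | .leftEdge a j k => ((a, j), .inl k)
    | .midEdge a b => ((a, b), .inr (.inl ()))
    -- The indices are swapped: path (a, b) enters `left a` by its b-th path and leaves `right b` by
    -- its a-th one, so no edge is used twice.
    | .rightEdge b j k => ((j, b), .inr (.inr k))
  invFun
    | ((a, j), .inl k) => .leftEdge a j k
    | ((a, b), .inr (.inl ())) => .midEdge a b
    | ((j, b), .inr (.inr k)) => .rightEdge b j k
  left_inv e := by cases e <;> rfl
  right_inv := by rintro ⟨⟨a, j⟩, k | k | k⟩ <;> rfl

instance (n : ℕ) : Fintype (BaseEdge n) := Fintype.ofEquiv _ (baseEdgeEquiv n).symm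

theorem card_baseEdge (n : ℕ) : Fintype.card (BaseEdge n) = n ^ 2 * (2 * n + 1) := by
  rw [Fintype.card_congr (baseEdgeEquiv n)]
  simp only [Fintype.card_prod, Fintype.card_fin, Fintype.card_sum, Fintype.card_unit]
  ring

/-- The base vertices as a disjoint union. -/
def baseVertexEquiv (n : ℕ) : BaseVertex n ≃
    Bool ⊕ (Fin n ⊕ Fin n) ⊕ ((Fin n × Fin n × Fin (n - 1)) ⊕ (Fin n × Fin n × Fin (n - 1))) where
  toFun
    | .s => .inl false
    | .t => .inl true
    | .left a => .inr (.inl (.inl a))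
    | .right a => .inr (.inl (.inr a))
    | .leftInner a j k => .inr (.inr (.inl (a, j, k)))
    | .rightInner a j k => .inr (.inr (.inr (a, j, k)))
  invFun
    | .inl false => .s
    | .inl true => .t
    | .inr (.inl (.inl a)) => .left a
    | .inr (.inl (.inr a)) => .right a
    | .inr (.inr (.inl (a, j, k))) => .leftInner a j k
    | .inr (.inr (.inr (a, j, k))) => .rightInner a j k
  left_inv e := by cases e <;> rfl
  right_inv := by rintro ((_ | _) | (_ | _) | _ | _) <;> rfl

instance (n : ℕ) : Fintype (BaseVertex n) := Fintype.ofEquiv _ (baseVertexEquiv n).symm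

theorem card_baseVertex (n : ℕ) :
    Fintype.card (BaseVertex n) = 2 + 2 * n + 2 * (n * n * (n - 1)) := by
  rw [Fintype.card_congr (baseVertexEquiv n)]
  simp only [Fintype.card_prod, Fintype.card_fin, Fintype.card_sum, Fintype.card_bool]
  ring

/-- The distance of a base vertex from `s`. -/
def BaseVertex.height {n : ℕ} : BaseVertex n → ℕ
  | .s => 0
  | .t => 2 * n + 1
  | .left _ => n
  | .right _ => n + 1
  | .leftInner _ _ k => k + 1
  | .rightInner _ _ k => n + 1 + (k + 1)

theorem height_leftPath {n : ℕ} (a j : Fin n) {k : ℕ} (hk : k ≤ n) :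
    (leftPath a j k).height = k := by
  unfold leftPath
  split_ifs with h h'
  · simp [BaseVertex.height, h]
  · simp only [BaseVertex.height]; omega
  · simp only [BaseVertex.height]; omega

theorem height_rightPath {n : ℕ} (b j : Fin n) {k : ℕ} (hk : k ≤ n) :
    (rightPath b j k).height = n + 1 + k := by
  unfold rightPath
  split_ifs with h h'
  · simp [BaseVertex.height, h]
  · simp only [BaseVertex.height]; omega
  · simp only [BaseVertex.height]; omega

theorem leftPath_last {n : ℕ} (a j : Fin n) : leftPath a j n = .left a := by
  have := a.pos
  rw [leftPath, if_neg (by omega), dif_neg (by omega)]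

theorem rightPath_last {n : ℕ} (b j : Fin n) : rightPath b j n = .t := by
  have := b.pos
  rw [rightPath, if_neg (by omega), dif_neg (by omega)]

theorem BaseEdge.height_head {n : ℕ} (e : BaseEdge n) : e.head.height = e.tail.height + 1 := by
  cases e with
  | leftEdge a j k =>
    rw [head, tail, height_leftPath a j k.2.le, height_leftPath a j k.2]
  | midEdge a b => rfl
  | rightEdge b j k =>
    rw [head, tail, height_rightPath b j k.2.le, height_rightPath b j k.2]
    rfl

theorem BaseEdge.tail_ne_head {n : ℕ} (e : BaseEdge n) : e.tail ≠ e.head := fun h => by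
  have := e.height_head
  rw [← h] at this
  omega

/-- The edge number `q` of the path with index `(a, b)`, which runs from `s` to `left a`, to
`right b` and to `t`. -/
def basePathEdge {n : ℕ} (a b : Fin n) (q : ℕ) : BaseEdge n :=
  if h : q < n then .leftEdge a b ⟨q, h⟩
  else if h : n < q ∧ q - (n + 1) < n then .rightEdge b a ⟨q - (n + 1), h.2⟩
  -- This is the case q = n, and also the default for q > 2n, which still belongs to the path (a,
  -- b).
  else .midEdge a b

/-- The vertex number `q` of the path with index `(a, b)`. -/
def basePathVertex {n : ℕ} (a b : Fin n) (q : ℕ) : BaseVertex n :=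
  if q ≤ n then leftPath a b q else rightPath b a (q - (n + 1))

theorem tail_basePathEdge {n : ℕ} (a b : Fin n) {q : ℕ} (hq : q < 2 * n + 1) :
    (basePathEdge a b q).tail = basePathVertex a b q := by
  unfold basePathEdge basePathVertex
  split_ifs with h h' h' h'
  · rfl
  · omega
  · omega
  · rfl
  · rw [show q = n by omega, leftPath_last]; rfl
  · omega

theorem head_basePathEdge {n : ℕ} (a b : Fin n) {q : ℕ} (hq : q < 2 * n + 1) :
    (basePathEdge a b q).head = basePathVertex a b (q + 1) := by
  unfold basePathEdge basePathVertex
  split_ifs with h h' h' h'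
  · rfl
  · omega
  · omega
  · simp only [BaseEdge.head]; congr 1; omega
  · omega
  · rw [show q = n by omega, show n + 1 - (n + 1) = 0 by omega]; rfl

theorem basePathVertex_zero {n : ℕ} (a b : Fin n) : basePathVertex a b 0 = .s := by
  simp [basePathVertex, leftPath]

theorem basePathVertex_last {n : ℕ} (a b : Fin n) : basePathVertex a b (2 * n + 1) = .t := by
  rw [basePathVertex, if_neg (by omega), show 2 * n + 1 - (n + 1) = n by omega, rightPath_last]

theorem height_basePathVertex {n : ℕ} (a b : Fin n) {q : ℕ} (hq : q ≤ 2 * n + 1) :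
    (basePathVertex a b q).height = q := by
  unfold basePathVertex
  split_ifs with h
  · exact height_leftPath a b h
  · rw [height_rightPath b a (by omega)]; omega

/-- This is the edge-disjointness of the n² paths: an edge determines the path it lies on. The
default edge makes a bound on `q` unnecessary. -/
theorem baseEdgeEquiv_basePathEdge {n : ℕ} (a b : Fin n) (q : ℕ) :
    (baseEdgeEquiv n (basePathEdge a b q)).1 = (a, b) := by
  unfold basePathEdge
  split_ifs <;> rfl

/-! ### Replacing edges -/

section ReplaceEdges

variable {n : ℕ} {X : TerminalGraph}

theorem place_source (e : BaseEdge n) : place X e X.source = .inl e.tail := by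
  rw [place, dif_pos rfl]

theorem place_sink (hX : X.source ≠ X.sink) (e : BaseEdge n) :
    place X e X.sink = .inl e.head := by
  rw [place, dif_neg hX.symm, dif_pos rfl]

theorem place_inner (e : BaseEdge n) (v : {v : X.V // v ≠ X.source ∧ v ≠ X.sink}) :
    place X e v = .inr (e, v) := by
  rw [place, dif_neg v.2.1, dif_neg v.2.2]

theorem place_injective (e : BaseEdge n) : Function.Injective (place X e) := by
  intro v w h
  unfold place at h
  have := e.tail_ne_head
  have := e.tail_ne_head.symm
  split_ifs at h <;> simp_all

theorem adj_place (e : BaseEdge n) {a b : X.V} (h : X.graph.Adj a b) :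
    (replaceEdges n X).graph.Adj (place X e a) (place X e b) :=
  (SimpleGraph.fromRel_adj _ _ _).2
    ⟨(place_injective e).ne h.ne, .inl ⟨e, a, b, h, rfl, rfl⟩⟩

theorem exists_place_of_adj {x y : ReplacedVertex n X} (h : (replaceEdges n X).graph.Adj x y) :
    ∃ (e : BaseEdge n) (a b : X.V), X.graph.Adj a b ∧ place X e a = x ∧ place X e b = y := by
  obtain ⟨-, h | ⟨e, a, b, hab, ha, hb⟩⟩ := (SimpleGraph.fromRel_adj _ _ _).1 h
  · exact h
  · exact ⟨e, b, a, hab.symm, hb, ha⟩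

/-- The function on the vertices after replacement that is `φ` on the base vertices and `g e` on the
copy replacing `e`. -/
def glue {β : Type*} (φ : BaseVertex n → β) (g : BaseEdge n → X.V → β) : ReplacedVertex n X → β :=
  Sum.elim φ fun p => g p.1 p.2.1

theorem glue_place {β : Type*} {φ : BaseVertex n → β} {g : BaseEdge n → X.V → β}
    (hs : ∀ e, g e X.source = φ e.tail) (ht : ∀ e, g e X.sink = φ e.head) (e : BaseEdge n)
    (v : X.V) : glue φ g (place X e v) = g e v := by
  unfold place
  split_ifs with h h'
  · rw [h, hs]; rfl
  · rw [h', ht]; rfl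
  · rfl

/-- The retraction onto the copy replacing `e`, which contracts everything nearer to `s` into the
source and everything nearer to `t` into the sink. -/
noncomputable def retraction (e : BaseEdge n) : ReplacedVertex n X → X.V :=
  glue (fun β => if β.height ≤ e.tail.height then X.source else X.sink) fun f v =>
    if f.tail.height = e.tail.height then v
    -- Copies at the same height as `e` are folded onto `X` along with the copy at `e`, so the map
    -- depends on heights only.
    else if f.tail.height < e.tail.height then X.source else X.sink

theorem retraction_place (e f : BaseEdge n) (v : X.V) : retraction e (place X f v) =
    if f.tail.height = e.tail.height then v
    else if f.tail.height < e.tail.height then X.source else X.sink := by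
  refine glue_place (fun f => ?_) (fun f => ?_) f v
  · split_ifs <;> first | rfl | omega
  · have := f.height_head
    split_ifs <;> first | rfl | omega

theorem retraction_place_self (e : BaseEdge n) (v : X.V) : retraction e (place X e v) = v := by
  rw [retraction_place, if_pos rfl]

/-- Replacing edges by copies of `X` does not shorten the distances within a copy. -/
theorem pathDist_le_pathDist_place (e : BaseEdge n) (x y : X.V) :
    pathDist X.graph x y ≤ pathDist (replaceEdges n X).graph (place X e x) (place X e y) := by
  -- The retraction does not increase distances and is a left inverse of `place X e`.
  have := pathDist_le_of_collapse (H := (replaceEdges n X).graph) (H' := X.graph)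
    (r := retraction e) (fun a b h => ?_) (place X e x) (place X e y)
  · rwa [retraction_place_self, retraction_place_self] at this
  · obtain ⟨f, a, b, hab, rfl, rfl⟩ := exists_place_of_adj h
    simp only [retraction_place]
    split_ifs
    · exact .inr hab
    · exact .inl rfl
    · exact .inl rfl

/-! ### Heights and climbs -/

/-- `h` vanishes at the source, is `D` at the sink, and changes by at most one along edges. -/
structure IsHeight (X : TerminalGraph) (D : ℕ) (h : X.V → ℕ) : Prop where
  source : h X.source = 0
  sink : h X.sink = D
  adj : ∀ a b, X.graph.Adj a b → h a ≤ h b + 1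

/-- The height after replacement. -/
def replacedHeight (D : ℕ) (h : X.V → ℕ) : (replaceEdges n X).V → ℕ :=
  glue (fun β => β.height * D) fun e v => e.tail.height * D + h v

variable {D : ℕ} {h : X.V → ℕ}

theorem replacedHeight_place (hh : IsHeight X D h) (e : BaseEdge n) (v : X.V) :
    replacedHeight D h (place X e v) = e.tail.height * D + h v :=
  glue_place (fun e => by rw [hh.source, add_zero])
    (fun e => by rw [hh.sink, e.height_head]; ring) e v

/-- Every edge after replacement lies inside a single copy, so the Lipschitz condition is checked
copy by copy. -/
theorem lipschitz_glue {φ : BaseVertex n → ℕ} {g : BaseEdge n → X.V → ℕ}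
    (hs : ∀ e, g e X.source = φ e.tail) (ht : ∀ e, g e X.sink = φ e.head)
    (hg : ∀ e a b, X.graph.Adj a b → g e a ≤ g e b + 1) (x y : (replaceEdges n X).V)
    (hxy : (replaceEdges n X).graph.Adj x y) : glue φ g x ≤ glue φ g y + 1 := by
  obtain ⟨e, a, b, hab, rfl, rfl⟩ := exists_place_of_adj hxy
  rw [glue_place hs ht, glue_place hs ht]
  exact hg e a b hab

theorem IsHeight.replaceEdges (hh : IsHeight X D h) :
    IsHeight (replaceEdges n X) ((2 * n + 1) * D) (replacedHeight D h) where
  source := by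
    change BaseVertex.height .s * D = 0
    simp [BaseVertex.height]
  sink := rfl
  adj := lipschitz_glue (fun e => by rw [hh.source, add_zero])
    (fun e => by rw [hh.sink, e.height_head]; ring) fun e a b hab => by
      have := hh.adj a b hab
      omega

/-- `P` holds along the consecutive vertices of a sequence that climbs from the source to the
sink. -/
def HasClimb (X : TerminalGraph) (D : ℕ) (h : X.V → ℕ) (P : X.V → X.V → Prop) : Prop :=
  ∃ p : ℕ → X.V, p 0 = X.source ∧ p D = X.sink ∧ (∀ k ≤ D, h (p k) = k) ∧
    ∀ k < D, P (p k) (p (k + 1))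

/-- Climbs through the copies along a base path combine to a climb. -/
theorem HasClimb.replaceEdges (hX : X.source ≠ X.sink) (hh : IsHeight X D h) (hD : 0 < D)
    {P : (replaceEdges n X).V → (replaceEdges n X).V → Prop} (a b : Fin n)
    (hP : ∀ q < 2 * n + 1, HasClimb X D h fun x y =>
      P (place X (basePathEdge a b q) x) (place X (basePathEdge a b q) y)) :
    HasClimb (replaceEdges n X) ((2 * n + 1) * D) (replacedHeight D h) P := by
  have : Nonempty X.V := ⟨X.source⟩
  choose! p p0 pD ph pP using hP
  let r : ℕ → (_root_.replaceEdges n X).V := fun k =>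
    -- Quotient by `D` selects the copy, remainder the position in it; at the final index the
    -- quotient is out of range, so the sink is set by hand.
    if k < (2 * n + 1) * D then place X (basePathEdge a b (k / D)) (p (k / D) (k % D))
    else .inl .t
  have hlt : ∀ k < (2 * n + 1) * D,
      r k = place X (basePathEdge a b (k / D)) (p (k / D) (k % D)) := fun k hk => if_pos hk
  have hlast : r ((2 * n + 1) * D) = .inl .t := if_neg (lt_irrefl _)
  have hr' : ∀ q k, q < 2 * n + 1 → k < D →
      r (q * D + k) = place X (basePathEdge a b q) (p q k) := by
    intro q k hq hk
    have h1 : (q * D + k) / D = q := by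
      rw [add_comm, Nat.add_mul_div_right _ _ hD, Nat.div_eq_of_lt hk, zero_add]
    have h2 : (q * D + k) % D = k := by
      rw [add_comm, Nat.add_mul_mod_self_right, Nat.mod_eq_of_lt hk]
    have h3 : q * D + k < (2 * n + 1) * D := by
      have := Nat.mul_le_mul_right D (Nat.succ_le_of_lt hq)
      rw [Nat.succ_mul] at this
      omega
    rw [hlt _ h3, h1, h2]
  have hr : ∀ q k, q < 2 * n + 1 → k ≤ D →
      r (q * D + k) = place X (basePathEdge a b q) (p q k) := by
    intro q k hq hk
    rcases hk.lt_or_eq with hk | rfl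
    · exact hr' q k hq hk
    -- The end of one copy and the start of the next are the same base vertex, so the two
    -- descriptions of the sequence agree there.
    · rw [pD q hq, place_sink hX, head_basePathEdge a b hq, ← Nat.succ_mul]
      rcases (Nat.succ_le_of_lt hq).lt_or_eq with hq' | hq'
      · have := hr' (q + 1) 0 hq' hD
        rw [p0 _ hq', place_source, tail_basePathEdge a b hq'] at this
        exact this
      · rw [hq', show q + 1 = 2 * n + 1 from hq', basePathVertex_last]
        exact hlast
  have hsplit : ∀ k < (2 * n + 1) * D, ∃ q k', q < 2 * n + 1 ∧ k' < D ∧ k = q * D + k' :=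
    fun k hk => ⟨k / D, k % D, Nat.div_lt_of_lt_mul (by rwa [mul_comm]), Nat.mod_lt _ hD,
      (Nat.div_add_mod' k D).symm⟩
  refine ⟨r, ?_, ?_, fun k hk => ?_, fun k hk => ?_⟩
  · have := hr 0 0 (by omega) hD.le
    rw [p0 0 (by omega), place_source, tail_basePathEdge a b (by omega), basePathVertex_zero,
      zero_mul] at this
    exact this
  · exact hlast
  · rcases hk.lt_or_eq with hk | rfl
    · obtain ⟨q, k, hq, hk', rfl⟩ := hsplit k hk
      rw [hr q k hq hk'.le, replacedHeight_place hh, tail_basePathEdge a b hq,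
        height_basePathVertex a b hq.le, ph q hq k hk'.le]
    · rw [hlast]
      rfl
  · obtain ⟨q, k, hq, hk', rfl⟩ := hsplit k hk
    rw [add_assoc, hr q k hq hk'.le, hr q (k + 1) hq hk']
    exact pP q hq k hk'

end ReplaceEdges

/-! ### A complete minor in the target -/

section FatMinor

variable {n : ℕ} {X : TerminalGraph} {D : ℕ} {h : X.V → ℕ}

/-- The distance of the vertex at height `k` on a climb through the copy replacing `midEdge a b`
from `left c` or `right c`, truncated at `D`. -/
def coreDist {n : ℕ} (D : ℕ) (c a b : Fin n) (k : ℕ) : ℕ :=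
  if a = c then (if b = c then 0 else k) else if b = c then D - k else D

/-- Put 0 at `left c` and `right c` and `D` at the other base vertices, and interpolate along each
copy by the height. A Lipschitz function is all that is needed to bound distances from below. -/
theorem exists_lipschitz_coreDist (hh : IsHeight X D h) (c : Fin n) :
    ∃ F : (replaceEdges n X).V → ℕ, (∀ x y, (replaceEdges n X).graph.Adj x y → F x ≤ F y + 1) ∧
      ∀ a b v, F (place X (.midEdge a b) v) = coreDist D c a b (h v) := by
  classical
  let A : BaseVertex n → Prop := fun β => β = .left c ∨ β = .right c
  let φ : BaseVertex n → ℕ := fun β => if A β then 0 else D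
  let g : BaseEdge n → X.V → ℕ := fun e v =>
    if A e.tail then (if A e.head then 0 else h v) else if A e.head then D - h v else D
  have hs : ∀ e, g e X.source = φ e.tail := by
    intro e
    simp only [g, φ, hh.source]
    split_ifs <;> simp
  have ht : ∀ e, g e X.sink = φ e.head := by
    intro e
    simp only [g, φ, hh.sink]
    split_ifs <;> simp
  refine ⟨glue φ g, lipschitz_glue hs ht fun e a b hab => ?_, fun a b v => ?_⟩
  · have h1 := hh.adj a b hab
    have h2 := hh.adj b a hab.symm
    simp only [g]
    split_ifs <;> omega
  · rw [glue_place hs ht]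
    simp [g, A, coreDist, BaseEdge.tail, BaseEdge.head]

/-- A tent over one copy vanishes at both its terminals, hence extends by zero; it shows that the
middle of a copy is far from every other copy. -/
theorem exists_lipschitz_tent (hh : IsHeight X D h) (e : BaseEdge n) :
    ∃ F : (replaceEdges n X).V → ℕ, (∀ x y, (replaceEdges n X).graph.Adj x y → F x ≤ F y + 1) ∧
      (∀ v, F (place X e v) = min (h v) (D - h v)) ∧ ∀ f v, f ≠ e → F (place X f v) = 0 := by
  classical
  let g : BaseEdge n → X.V → ℕ := fun f v => if f = e then min (h v) (D - h v) else 0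
  have hs : ∀ e, g e X.source = 0 := by
    intro e
    simp [g, hh.source]
  have ht : ∀ e, g e X.sink = 0 := by
    intro e
    simp [g, hh.sink]
  refine ⟨glue (fun _ => 0) g, lipschitz_glue hs ht fun e a b hab => ?_, fun v => ?_,
    fun f v hf => ?_⟩
  · have h1 := hh.adj a b hab
    have h2 := hh.adj b a hab.symm
    simp only [g]
    split_ifs <;> omega
  · rw [glue_place hs ht]
    simp [g]
  · rw [glue_place hs ht]
    simp [g, hf]

/-- If each copy of `X` has a climb along which the images of consecutive vertices are close, then
the target has a complete minor on `n` vertices. -/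
theorem isGraphMinor_top_of_hasClimb (hX : X.source ≠ X.sink) (hh : IsHeight X D h) (hD : 0 < D)
    {W : Type*} {G : SimpleGraph W} {ℓ : Sym2 W → ℝ≥0} {Φ : (replaceEdges n X).V → W}
    (hdom : ∀ x y, pathDist (replaceEdges n X).graph x y ≤ weightedDist G ℓ (Φ x) (Φ y))
    (hP : ∀ e, HasClimb X D h fun x y =>
      weightedDist G ℓ (Φ (place X e x)) (Φ (place X e y)) < ((D / 8 : ℝ≥0) : ℝ≥0∞)) :
    IsGraphMinor (⊤ : SimpleGraph (Fin n)) G := by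
  -- The minor uses only the copies on edges of K_{n,n}; the paths to s and t serve the later count
  -- of edge-disjoint paths.
  choose p p0 pD ph pP using fun a b : Fin n => hP (.midEdge a b)
  let x : Fin n → Fin n → ℕ → (replaceEdges n X).V := fun a b k => place X (.midEdge a b) (p a b k)
  have hx0 : ∀ a b, Φ (x a b 0) = Φ (.inl (.left a)) := by
    intro a b
    simp only [x, p0, place_source]
    rfl
  have hxD : ∀ a b, Φ (x a b D) = Φ (.inl (.right b)) := by
    intro a b
    simp only [x, pD, place_sink hX]
    rfl
  have hQ : ∀ a b k, ∃ (y : W) (q : G.Walk (Φ (x a b k)) y), k < D →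
      y = Φ (x a b (k + 1)) ∧ (q.edges.map ℓ).sum < (D / 8 : ℝ≥0) := by
    intro a b k
    by_cases hk : k < D
    · obtain ⟨q, hq⟩ := exists_walk_of_weightedDist_lt (pP a b k hk)
      exact ⟨_, q, fun _ => ⟨rfl, hq⟩⟩
    · exact ⟨_, .nil, fun hk' => absurd hk' hk⟩
  choose y q hq using hQ
  let Q : Fin n → Fin n → ℕ → Set W := fun a b k => {u | u ∈ (q a b k).support}
  have hstart : ∀ a b k, Φ (x a b k) ∈ Q a b k := fun a b k => (q a b k).start_mem_support
  have hend : ∀ a b k, k < D → Φ (x a b (k + 1)) ∈ Q a b k := fun a b k hk => by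
    rw [← (hq a b k hk).1]
    exact (q a b k).end_mem_support
  have hjoin : ∀ a b k u v, u ∈ Q a b k → v ∈ Q a b k → JoinedWithin G (Q a b k) u v :=
    fun a b k u v hu hv => .of_mem_support _ hu hv
  -- Two intersecting walks of length below D/8 put their starts less than D/4 apart in the target,
  -- hence also in the source by domination.
  have hclose : ∀ {a b k a' b' k' u}, k < D → k' < D → u ∈ Q a b k → u ∈ Q a' b' k' →
      ∀ F : (replaceEdges n X).V → ℕ, (∀ x y, (replaceEdges n X).graph.Adj x y → F x ≤ F y + 1) →
        4 * F (x a b k) < 4 * F (x a' b' k') + D := by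
    intro a b k a' b' k' u hk hk' hu hu' F hF
    have h1 := (hdom (x a b k) (x a' b' k')).trans
      (weightedDist_le_of_mem_support (ℓ := ℓ) (q a b k) (q a' b' k') hu hu')
    have h2 := h1.trans_lt (ENNReal.coe_lt_coe.2 (add_lt_add (hq a b k hk).2 (hq a' b' k' hk').2))
    obtain ⟨r, hr⟩ := exists_walk_of_pathDist_lt h2
    have h3 := r.le_add_length hF
    have h4 : 4 * r.length < D := by
      have : (r.length : ℝ) < D / 8 + D / 8 := by exact_mod_cast hr
      have : (4 * r.length : ℝ) < D := by linarith
      exact_mod_cast this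
    omega
  have hcore : ∀ {a b k a' b' k' u}, k < D → k' < D → u ∈ Q a b k → u ∈ Q a' b' k' →
      ∀ c, 4 * coreDist D c a b k < 4 * coreDist D c a' b' k' + D := by
    intro a b k a' b' k' u hk hk' hu hu' c
    obtain ⟨F, hF, hFv⟩ := exists_lipschitz_coreDist hh c
    have := hclose hk hk' hu hu' F hF
    simpa only [x, hFv, ph _ _ _ hk.le, ph _ _ _ hk'.le] using this
  have htent : ∀ {a b k a' b' k' u}, k < D → k' < D → u ∈ Q a b k → u ∈ Q a' b' k' →
      (a, b) ≠ (a', b') → 4 * min k (D - k) < D := by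
    intro a b k a' b' k' u hk hk' hu hu' hne
    obtain ⟨F, hF, hFe, hFf⟩ := exists_lipschitz_tent hh (.midEdge a b)
    have := hclose hk hk' hu hu' F hF
    have hne' : BaseEdge.midEdge a' b' ≠ .midEdge a b := by
      rintro ⟨⟩
      exact hne rfl
    simpa only [x, hFe, hFf _ _ hne', ph _ _ _ hk.le, mul_zero, zero_add] using this
  have hchain : ∀ (S : Set W) a b i j, i ≤ j → j ≤ D → Φ (x a b i) ∈ S →
      (∀ k, i ≤ k → k < j → Q a b k ⊆ S) → JoinedWithin G S (Φ (x a b i)) (Φ (x a b j)) := by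
    intro S a b i j hij
    induction j, hij using Nat.le_induction with
    | base => exact fun _ h _ => .refl h
    | succ j hij ih =>
      intro hj hi hS
      exact (ih (by omega) hi fun k hk hk' => hS k hk (by omega)).trans
        ((hjoin a b j _ _ (hstart a b j) (hend a b j hj)).mono (hS j hij (by omega)))
  -- The c-th set collects all short walks starting within D/4 of the c-th core, including those on
  -- the ends of copies incident with it.
  let K : Fin n → Set W := fun c =>
    {u | ∃ a b k, k < D ∧ 4 * coreDist D c a b k ≤ D ∧ u ∈ Q a b k}
  have hQK : ∀ {a b k c}, k < D → 4 * coreDist D c a b k ≤ D → Q a b k ⊆ K c :=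
    fun hk hc u hu => ⟨_, _, _, hk, hc, hu⟩
  have hself : ∀ (c : Fin n) k, coreDist D c c c k = 0 := fun c k => by simp [coreDist]
  have hleft : ∀ c, Φ (.inl (.left c)) ∈ K c := fun c =>
    ⟨c, c, 0, hD, by simp [hself], hx0 c c ▸ hstart c c 0⟩
  have hlr : ∀ c, JoinedWithin G (K c) (Φ (.inl (.left c))) (Φ (.inl (.right c))) := by
    intro c
    rw [← hx0 c c, ← hxD c c]
    exact hchain _ c c 0 D (Nat.zero_le _) le_rfl (hx0 c c ▸ hleft c)
      fun k _ hk => hQK hk (by simp [hself])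
  refine isGraphMinor_top_of_connectors K (fun c => Φ (.inl (.left c))) hleft ?_ ?_
    (fun a b => {u | ∃ k < D, u ∈ Q a b k}) ?_ ?_ ?_
  · rintro c u ⟨a, b, k, hk, hc, hu⟩
    refine JoinedWithin.trans ?_ ((hjoin a b k _ _ (hstart a b k) hu).mono (hQK hk hc))
    -- Go back along the climb to `left c` if the copy starts there, otherwise onward to `right c`;
    -- the core distance never increases on the way.
    by_cases ha : a = c
    · subst ha
      rw [← hx0 a b]
      refine hchain _ a b 0 k (Nat.zero_le _) hk.le (hx0 a b ▸ hleft a) fun j _ hj => hQK (by omega) ?_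
      simp only [coreDist, if_true] at hc ⊢
      split_ifs at hc ⊢ <;> omega
    · have hb : b = c := by
        by_contra hb
        simp only [coreDist, if_neg ha, if_neg hb] at hc
        omega
      subst hb
      refine (hlr b).trans ?_
      rw [← hxD a b]
      refine (hchain _ a b k D hk.le le_rfl (hQK hk hc (hstart a b k)) fun j hj hj' =>
        hQK hj' ?_).symm
      simp only [coreDist, if_neg ha, if_true] at hc ⊢
      omega
  · intro c c' hne
    rw [Set.disjoint_left]
    rintro u ⟨a, b, k, hk, hc, hu⟩ ⟨a', b', k', hk', hc', hu'⟩
    have h1 := hcore hk hk' hu hu' c'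
    -- Distinct cores are D apart, so being within D/4 of one means at least 3D/4 from the other,
    -- whereas the intersection would leave less than D/2.
    have h2 : 3 * D ≤ 4 * coreDist D c' a b k := by
      unfold coreDist at hc ⊢
      by_cases ha : a = c
      · subst ha
        rw [if_neg hne]
        split_ifs at hc ⊢ <;> omega
      · by_cases hb : b = c
        · subst hb
          rw [if_neg ha, if_pos rfl] at hc
          split_ifs <;> omega
        · rw [if_neg ha, if_neg hb] at hc
          omega
    omega
  · intro a b _
    refine ⟨Φ (.inl (.right b)), (hlr b).symm.left_mem, ?_⟩
    rw [← hx0 a b, ← hxD a b]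
    exact hchain _ a b 0 D (Nat.zero_le _) le_rfl ⟨0, hD, hstart a b 0⟩
      fun k _ hk u hu => ⟨k, hk, hu⟩
  · intro a b c _ ha hb
    rw [Set.disjoint_left]
    rintro u ⟨k, hk, hu⟩ ⟨a', b', k', hk', hc, hu'⟩
    -- A copy not incident with core c has truncated distance D from it, but meeting `K c` would
    -- force less than D/2.
    have := hcore hk hk' hu hu' c
    simp only [coreDist, if_neg ha.symm, if_neg hb.symm] at this hc
    omega
  · rintro a b a' b' hab _ hne u ⟨⟨k, hk, hu⟩, k', hk', hu'⟩
    -- Walks from different copies meet only near an end of the copy, and the walks starting there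
    -- belong to the set at that end.
    have h1 := htent hk hk' hu hu' hne
    by_cases h2 : 4 * k ≤ D
    · exact .inl (hQK hk (by simpa [coreDist, hab.ne'] using h2) hu)
    · exact .inr (hQK hk (by simp only [coreDist, hab.ne, if_false, if_true]; omega) hu)

end FatMinor

/-! ### Tree decompositions of the recursive graphs -/

/-- The base graph. -/
def baseGraph (n : ℕ) : SimpleGraph (BaseVertex n) :=
  SimpleGraph.fromRel fun x y => ∃ e : BaseEdge n, e.tail = x ∧ e.head = y

theorem leftPath_cases {n : ℕ} (a j : Fin n) (k : ℕ) :
    (k = 0 ∧ leftPath a j k = .s) ∨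
      (∃ h : k - 1 < n - 1, k ≠ 0 ∧ leftPath a j k = .leftInner a j ⟨k - 1, h⟩) ∨
      leftPath a j k = .left a := by
  unfold leftPath
  split_ifs with h h'
  · exact .inl ⟨h, rfl⟩
  · exact .inr (.inl ⟨h', h, rfl⟩)
  · exact .inr (.inr rfl)

theorem rightPath_cases {n : ℕ} (b j : Fin n) (k : ℕ) :
    (k = 0 ∧ rightPath b j k = .right b) ∨
      (∃ h : k - 1 < n - 1, k ≠ 0 ∧ rightPath b j k = .rightInner b j ⟨k - 1, h⟩) ∨
      rightPath b j k = .t := by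
  unfold rightPath
  split_ifs with h h'
  · exact .inl ⟨h, rfl⟩
  · exact .inr (.inl ⟨h', h, rfl⟩)
  · exact .inr (.inr rfl)

theorem leftPath_succ_of_lt {n : ℕ} (a j : Fin n) (k : Fin (n - 1)) :
    leftPath a j (k + 1) = .leftInner a j k := by
  have := k.2
  rw [leftPath, if_neg (by omega), dif_pos (by omega)]
  rfl

theorem rightPath_succ_of_lt {n : ℕ} (b j : Fin n) (k : Fin (n - 1)) :
    rightPath b j (k + 1) = .rightInner b j k := by
  have := k.2
  rw [rightPath, if_neg (by omega), dif_pos (by omega)]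
  rfl

/-- The bags of the decomposition of the base graph. -/
def baseBag {n : ℕ} : Option (Fin n) ⊕ BaseEdge n → Set (BaseVertex n)
  | .inl none => {.s, .t} ∪ Set.range .left
  -- With t and the left side in the bag, distinct right vertices are separated, so each takes the
  -- place of s in a bag of its own.
  | .inl (some b) => {.t, .right b} ∪ Set.range .left
  -- The far end `left a` is carried along the whole path from s; on the right, t plays this role.
  | .inr (.leftEdge a j k) => {.left a, leftPath a j k, leftPath a j (k + 1)}
  | .inr (.midEdge a b) => {.left a, .right b}
  | .inr (.rightEdge b j k) => {.t, rightPath b j k, rightPath b j (k + 1)}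

/-- The parent function of the decomposition of the base graph. -/
def baseParent {n : ℕ} : Option (Fin n) ⊕ BaseEdge n → Option (Fin n) ⊕ BaseEdge n
  | .inl _ => .inl none
  | .inr (.leftEdge a j k) =>
    if (k : ℕ) = 0 then .inl none else .inr (.leftEdge a j ⟨k - 1, by omega⟩)
  | .inr (.midEdge _ b) => .inl (some b)
  | .inr (.rightEdge b j k) =>
    if (k : ℕ) = 0 then .inl (some b) else .inr (.rightEdge b j ⟨k - 1, by omega⟩)

/-- The rank function of the decomposition of the base graph. -/
def baseRank {n : ℕ} : Option (Fin n) ⊕ BaseEdge n → ℕ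
  | .inl none => 0
  | .inl (some _) => 1
  | .inr (.leftEdge _ _ k) => k + 1
  | .inr (.midEdge _ _) => 2
  | .inr (.rightEdge _ _ k) => k + 2

theorem tail_mem_baseBag {n : ℕ} (e : BaseEdge n) : e.tail ∈ baseBag (.inr e) := by
  cases e <;> simp [baseBag, BaseEdge.tail]

theorem head_mem_baseBag {n : ℕ} (e : BaseEdge n) : e.head ∈ baseBag (.inr e) := by
  cases e <;> simp [baseBag, BaseEdge.head]

/-- The topmost bag is the root for s, t and the left side, the bag of b for `right b`, and for an
inner path vertex the bag of the edge leading into it. -/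
theorem baseBag_top {n : ℕ} (v : BaseVertex n) : ∃ τ : Option (Fin n) ⊕ BaseEdge n,
    ∀ i, v ∈ baseBag i → i = τ ∨ (i ≠ .inl none ∧ v ∈ baseBag (baseParent i)) := by
  cases v with
  | s =>
    refine ⟨.inl none, ?_⟩
    rintro ((_ | b) | ⟨a, j, k⟩ | ⟨a, b⟩ | ⟨b, j, k⟩) hi
    · exact .inl rfl
    · simp [baseBag] at hi
    · have h1 := leftPath_cases a j k
      have h2 := leftPath_cases a j (k + 1)
      simp only [baseBag, Set.mem_insert_iff, Set.mem_singleton_iff] at hi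
      have hk : (k : ℕ) = 0 := by
        rcases hi with hi | hi | hi
        · cases hi
        · rw [← hi] at h1
          simpa using h1
        · rw [← hi] at h2
          simp at h2
      simp [baseParent, hk, baseBag]
    · simp [baseBag] at hi
    · have h1 := rightPath_cases b j k
      have h2 := rightPath_cases b j (k + 1)
      simp only [baseBag, Set.mem_insert_iff, Set.mem_singleton_iff] at hi
      rcases hi with hi | hi | hi
      · cases hi
      · rw [← hi] at h1
        simp at h1
      · rw [← hi] at h2
        simp at h2
  | t =>
    refine ⟨.inl none, ?_⟩
    rintro ((_ | b) | ⟨a, j, k⟩ | ⟨a, b⟩ | ⟨b, j, k⟩) hi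
    · exact .inl rfl
    · simp [baseBag, baseParent]
    · have h1 := leftPath_cases a j k
      have h2 := leftPath_cases a j (k + 1)
      simp only [baseBag, Set.mem_insert_iff, Set.mem_singleton_iff] at hi
      rcases hi with hi | hi | hi
      · cases hi
      · rw [← hi] at h1
        simp at h1
      · rw [← hi] at h2
        simp at h2
    · simp [baseBag] at hi
    · refine .inr ⟨by simp, ?_⟩
      simp only [baseParent]
      split_ifs <;> simp [baseBag]
  | left a₀ =>
    refine ⟨.inl none, ?_⟩
    rintro ((_ | b) | ⟨a, j, k⟩ | ⟨a, b⟩ | ⟨b, j, k⟩) hi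
    · exact .inl rfl
    · simp [baseBag, baseParent]
    · refine .inr ⟨by simp, ?_⟩
      have h1 := leftPath_cases a j k
      have h2 := leftPath_cases a j (k + 1)
      simp only [baseBag, Set.mem_insert_iff, Set.mem_singleton_iff] at hi
      have ha : a₀ = a := by
        rcases hi with hi | hi | hi
        · cases hi
          rfl
        · rw [← hi] at h1
          simpa using h1
        · rw [← hi] at h2
          simpa using h2
      simp only [baseParent]
      split_ifs <;> simp [baseBag, ha]
    · simp [baseBag, baseParent]
    · have h1 := rightPath_cases b j k
      have h2 := rightPath_cases b j (k + 1)
      simp only [baseBag, Set.mem_insert_iff, Set.mem_singleton_iff] at hi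
      rcases hi with hi | hi | hi
      · cases hi
      · rw [← hi] at h1
        simp at h1
      · rw [← hi] at h2
        simp at h2
  | right b₀ =>
    refine ⟨.inl (some b₀), ?_⟩
    rintro ((_ | b) | ⟨a, j, k⟩ | ⟨a, b⟩ | ⟨b, j, k⟩) hi
    · simp [baseBag] at hi
    · simp only [baseBag, Set.mem_union, Set.mem_insert_iff, Set.mem_singleton_iff] at hi
      simp at hi
      simp [hi]
    · have h1 := leftPath_cases a j k
      have h2 := leftPath_cases a j (k + 1)
      simp only [baseBag, Set.mem_insert_iff, Set.mem_singleton_iff] at hi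
      rcases hi with hi | hi | hi
      · cases hi
      · rw [← hi] at h1
        simp at h1
      · rw [← hi] at h2
        simp at h2
    · simp [baseBag] at hi
      simp [baseBag, baseParent, hi]
    · have h1 := rightPath_cases b j k
      have h2 := rightPath_cases b j (k + 1)
      simp only [baseBag, Set.mem_insert_iff, Set.mem_singleton_iff] at hi
      have hk : (k : ℕ) = 0 ∧ b₀ = b := by
        rcases hi with hi | hi | hi
        · cases hi
        · rw [← hi] at h1
          simpa using h1
        · rw [← hi] at h2
          simp at h2
      simp [baseParent, hk, baseBag]
  | leftInner a₀ j₀ k₀ =>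
    have := k₀.2
    refine ⟨.inr (.leftEdge a₀ j₀ ⟨k₀, by omega⟩), ?_⟩
    rintro ((_ | b) | ⟨a, j, k⟩ | ⟨a, b⟩ | ⟨b, j, k⟩) hi
    · simp [baseBag] at hi
    · simp [baseBag] at hi
    · have h1 := leftPath_cases a j k
      have h2 := leftPath_cases a j (k + 1)
      simp only [baseBag, Set.mem_insert_iff, Set.mem_singleton_iff] at hi
      rcases hi with hi | hi | hi
      · cases hi
      · refine .inr ⟨by simp, ?_⟩
        rw [← hi] at h1
        have hk : (k : ℕ) ≠ 0 := by
          rintro h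
          simp [h] at h1
        rw [baseParent, if_neg hk, hi]
        simp only [baseBag, Nat.sub_add_cancel (Nat.pos_of_ne_zero hk)]
        simp
      · rw [← hi] at h2
        simp at h2
        obtain ⟨rfl, rfl, _, rfl⟩ := h2
        exact .inl rfl
    · simp [baseBag] at hi
    · have h1 := rightPath_cases b j k
      have h2 := rightPath_cases b j (k + 1)
      simp only [baseBag, Set.mem_insert_iff, Set.mem_singleton_iff] at hi
      rcases hi with hi | hi | hi
      · cases hi
      · rw [← hi] at h1
        simp at h1
      · rw [← hi] at h2
        simp at h2
  | rightInner b₀ j₀ k₀ =>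
    have := k₀.2
    refine ⟨.inr (.rightEdge b₀ j₀ ⟨k₀, by omega⟩), ?_⟩
    rintro ((_ | b) | ⟨a, j, k⟩ | ⟨a, b⟩ | ⟨b, j, k⟩) hi
    · simp [baseBag] at hi
    · simp [baseBag] at hi
    · have h1 := leftPath_cases a j k
      have h2 := leftPath_cases a j (k + 1)
      simp only [baseBag, Set.mem_insert_iff, Set.mem_singleton_iff] at hi
      rcases hi with hi | hi | hi
      · cases hi
      · rw [← hi] at h1
        simp at h1
      · rw [← hi] at h2
        simp at h2
    · simp [baseBag] at hi
    · have h1 := rightPath_cases b j k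
      have h2 := rightPath_cases b j (k + 1)
      simp only [baseBag, Set.mem_insert_iff, Set.mem_singleton_iff] at hi
      rcases hi with hi | hi | hi
      · cases hi
      · refine .inr ⟨by simp, ?_⟩
        rw [← hi] at h1
        have hk : (k : ℕ) ≠ 0 := by
          rintro h
          simp [h] at h1
        rw [baseParent, if_neg hk, hi]
        simp only [baseBag, Nat.sub_add_cancel (Nat.pos_of_ne_zero hk)]
        simp
      · rw [← hi] at h2
        simp at h2
        obtain ⟨rfl, rfl, _, rfl⟩ := h2
        exact .inl rfl

/-- The decomposition of the base graph. -/
def baseDecomposition (n : ℕ) : RootedDecomposition (baseGraph n) where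
  I := Option (Fin n) ⊕ BaseEdge n
  finite := inferInstance
  root := .inl none
  parent := baseParent
  rank := baseRank
  rank_lt := by
    rintro ((_ | b) | ⟨a, j, k⟩ | ⟨a, b⟩ | ⟨b, j, k⟩) hi
    · exact absurd rfl hi
    · simp [baseParent, baseRank]
    · simp only [baseParent]
      split_ifs <;> simp only [baseRank] <;> omega
    · simp [baseParent, baseRank]
    · simp only [baseParent]
      split_ifs <;> simp only [baseRank] <;> omega
  bag := baseBag
  cover_vertex v := by
    cases v with
    | s => exact ⟨.inl none, by simp [baseBag]⟩
    | t => exact ⟨.inl none, by simp [baseBag]⟩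
    | left a => exact ⟨.inl none, by simp [baseBag]⟩
    | right b => exact ⟨.inl (some b), by simp [baseBag]⟩
    | leftInner a j k =>
      refine ⟨.inr (.leftEdge a j ⟨k, by omega⟩), ?_⟩
      rw [← leftPath_succ_of_lt]
      exact head_mem_baseBag (.leftEdge a j ⟨k, by omega⟩)
    | rightInner b j k =>
      refine ⟨.inr (.rightEdge b j ⟨k, by omega⟩), ?_⟩
      rw [← rightPath_succ_of_lt]
      exact head_mem_baseBag (.rightEdge b j ⟨k, by omega⟩)
  cover_edge u v huv := by
    obtain ⟨-, ⟨e, rfl, rfl⟩ | ⟨e, rfl, rfl⟩⟩ := (SimpleGraph.fromRel_adj _ _ _).1 huv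
    · exact ⟨.inr e, tail_mem_baseBag e, head_mem_baseBag e⟩
    · exact ⟨.inr e, head_mem_baseBag e, tail_mem_baseBag e⟩
  top := baseBag_top

theorem encard_baseBag_le {n : ℕ} (hn : 1 ≤ n) (i : Option (Fin n) ⊕ BaseEdge n) :
    (baseBag i).encard ≤ ((n + 1 + 1 : ℕ) : ℕ∞) := by
  have hpair : ∀ x y : BaseVertex n, ({x, y} : Set (BaseVertex n)).encard ≤ 2 := by
    intro x y
    refine (Set.encard_insert_le _ _).trans ?_
    rw [Set.encard_singleton]
    norm_num
  have hrange : (Set.range (BaseVertex.left : Fin n → BaseVertex n)).encard ≤ n := by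
    rw [← Set.image_univ]
    refine (Set.encard_image_le _ _).trans ?_
    simp
  have hbig : ∀ x y : BaseVertex n,
      (({x, y} : Set (BaseVertex n)) ∪ Set.range .left).encard ≤ ((n + 1 + 1 : ℕ) : ℕ∞) := by
    intro x y
    refine (Set.encard_union_le _ _).trans ((add_le_add (hpair x y) hrange).trans ?_)
    rw [add_comm]
    norm_cast
  have htriple : ∀ x y z : BaseVertex n,
      ({x, y, z} : Set (BaseVertex n)).encard ≤ ((n + 1 + 1 : ℕ) : ℕ∞) := by
    intro x y z
    refine (Set.encard_insert_le _ _).trans ((add_le_add_left (hpair y z) 1).trans ?_)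
    norm_cast
    omega
  rcases i with (_ | b) | ⟨a, j, k⟩ | ⟨a, b⟩ | ⟨b, j, k⟩
  · exact hbig _ _
  · exact hbig _ _
  · exact htriple _ _ _
  · refine (hpair _ _).trans ?_
    norm_cast
    omega
  · exact htriple _ _ _

/-! ### Gluing decompositions along replaced edges -/

section ReplaceDecomposition

variable {n : ℕ} {X : TerminalGraph}

theorem place_eq_inl {e : BaseEdge n} {v : X.V} {β : BaseVertex n} (h : place X e v = .inl β) :
    (v = X.source ∧ β = e.tail) ∨ (v = X.sink ∧ β = e.head) := by
  unfold place at h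
  split_ifs at h with h1 h2
  · exact .inl ⟨h1, (Sum.inl.inj h).symm⟩
  · exact .inr ⟨h2, (Sum.inl.inj h).symm⟩

theorem place_eq_inr {e f : BaseEdge n} {v : X.V} {w : {v : X.V // v ≠ X.source ∧ v ≠ X.sink}}
    (h : place X e v = .inr (f, w)) : e = f ∧ v = w := by
  unfold place at h
  split_ifs at h with h1 h2
  obtain ⟨rfl, rfl⟩ := Prod.ext_iff.1 (Sum.inr.inj h)
  exact ⟨rfl, rfl⟩

open Classical in
/-- Decompositions of the base graph and of `X` combine to one of the graph after replacement. -/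
noncomputable def RootedDecomposition.replaceEdges (B : RootedDecomposition (baseGraph n))
    (D : RootedDecomposition X.graph) (hs : X.source ∈ D.bag D.root) (ht : X.sink ∈ D.bag D.root)
    (home : BaseEdge n → B.I) (hhome : ∀ e, e.tail ∈ B.bag (home e) ∧ e.head ∈ B.bag (home e)) :
    RootedDecomposition (replaceEdges n X).graph where
  I := B.I ⊕ (BaseEdge n × D.I)
  finite := by
    have := B.finite
    have := D.finite
    infer_instance
  root := .inl B.root
  parent := Sum.elim (fun x => .inl (B.parent x)) fun p =>
    -- The tree of each copy hangs by its root below a node whose bag contains both ends of the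
    -- replaced edge.
    if p.2 = D.root then .inl (home p.1) else .inr (p.1, D.parent p.2)
  rank := Sum.elim B.rank fun p => B.rank (home p.1) + 1 + D.rank p.2
  rank_lt := by
    rintro (x | ⟨e, y⟩) hx
    · exact B.rank_lt x fun h => hx (congrArg _ h)
    · simp only [Sum.elim_inr]
      split_ifs with hy
      · simp only [Sum.elim_inl]
        omega
      · have := D.rank_lt y hy
        simp only [Sum.elim_inr]
        omega
  bag := Sum.elim (fun x => Sum.inl '' B.bag x) fun p => place X p.1 '' D.bag p.2
  cover_vertex := by
    rintro (β | ⟨e, v⟩)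
    · obtain ⟨i, hi⟩ := B.cover_vertex β
      exact ⟨.inl i, β, hi, rfl⟩
    · obtain ⟨i, hi⟩ := D.cover_vertex v
      exact ⟨.inr (e, i), v, hi, place_inner e v⟩
  cover_edge u v huv := by
    obtain ⟨e, a, b, hab, rfl, rfl⟩ := exists_place_of_adj huv
    obtain ⟨i, ha, hb⟩ := D.cover_edge a b hab
    exact ⟨.inr (e, i), ⟨a, ha, rfl⟩, ⟨b, hb, rfl⟩⟩
  top := by
    rintro (β | ⟨e, v⟩)
    · obtain ⟨τ, hτ⟩ := B.top β
      refine ⟨.inl τ, ?_⟩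
      rintro (x | ⟨e, y⟩) ⟨w, hw, hwe⟩
      · obtain rfl := Sum.inl.inj hwe
        rcases hτ x hw with rfl | ⟨hx, hx'⟩
        · exact .inl rfl
        · exact .inr ⟨fun h => hx (Sum.inl.inj h), w, hx', rfl⟩
      · refine .inr ⟨by simp, ?_⟩
        have hend := place_eq_inl hwe
        simp only [Sum.elim_inr]
        split_ifs with hy
        · refine ⟨β, ?_, rfl⟩
          rcases hend with ⟨-, rfl⟩ | ⟨-, rfl⟩
          · exact (hhome e).1
          · exact (hhome e).2
        · refine ⟨w, ?_, hwe⟩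
          -- A terminal lies in the root bag, so the root is its topmost node, and any other node
          -- containing it has a parent containing it.
          have hroot : w ∈ D.bag D.root := by
            rcases hend with ⟨rfl, -⟩ | ⟨rfl, -⟩
            · exact hs
            · exact ht
          obtain ⟨σ, hσ⟩ := D.top w
          have hσ' : D.root = σ := (hσ _ hroot).resolve_right fun h => h.1 rfl
          exact ((hσ y hw).resolve_left fun h => hy (h.trans hσ'.symm)).2
    · obtain ⟨τ, hτ⟩ := D.top v
      refine ⟨.inr (e, τ), ?_⟩
      rintro (x | ⟨f, y⟩) ⟨w, hw, hwe⟩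
      · cases hwe
      · obtain ⟨rfl, rfl⟩ := place_eq_inr hwe
        rcases hτ y hw with rfl | ⟨hy, hy'⟩
        · exact .inl rfl
        · refine .inr ⟨by simp, ?_⟩
          simp only [Sum.elim_inr, if_neg hy]
          exact ⟨v, hy', hwe⟩

end ReplaceDecomposition

/-- Keeping both terminals in the root bag is what lets the induction hang this decomposition below
a base bag. -/
theorem exists_rootedDecomposition_recGraph {n : ℕ} (hn : 1 ≤ n) (i : ℕ) :
    ∃ D : RootedDecomposition (recGraph n i).graph, (recGraph n i).source ∈ D.bag D.root ∧
      (recGraph n i).sink ∈ D.bag D.root ∧ ∀ j, (D.bag j).encard ≤ ((n + 1 + 1 : ℕ) : ℕ∞) := by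
  induction i with
  | zero =>
    refine ⟨{ I := Unit, finite := inferInstance, root := (), parent := id, rank := fun _ => 0
              rank_lt := fun i hi => absurd rfl hi, bag := fun _ => Set.univ
              cover_vertex := fun v => ⟨(), trivial⟩
              cover_edge := fun u v _ => ⟨(), trivial, trivial⟩
              top := fun v => ⟨(), fun _ _ => .inl rfl⟩ }, trivial, trivial, fun _ => ?_⟩
    have h : (Set.univ : Set Bool).encard = 2 := by simp [Set.encard_pair]
    refine (show _ = _ from h).le.trans ?_
    norm_cast
    omega
  | succ i ih =>
    obtain ⟨D, hs, ht, hD⟩ := ih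
    refine ⟨(baseDecomposition n).replaceEdges D hs ht .inr
      fun e => ⟨tail_mem_baseBag e, head_mem_baseBag e⟩, ?_, ?_, ?_⟩
    · exact ⟨.s, by simp [baseDecomposition, baseBag], rfl⟩
    · exact ⟨.t, by simp [baseDecomposition, baseBag], rfl⟩
    · rintro (x | ⟨e, y⟩)
      · exact (Set.encard_image_le _ _).trans (encard_baseBag_le hn x)
      · exact (Set.encard_image_le _ _).trans (hD y)

theorem treewidth_recGraph_le {n : ℕ} (hn : 1 ≤ n) (i : ℕ) :
    treewidth (recGraph n i).graph ≤ ((n + 1 : ℕ) : ℕ∞) := by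
  obtain ⟨D, -, -, hD⟩ := exists_rootedDecomposition_recGraph hn i
  exact D.treewidth_le hD

/-! ### Basic properties of the recursive graphs -/

theorem source_ne_sink_recGraph (n i : ℕ) : (recGraph n i).source ≠ (recGraph n i).sink := by
  cases i with
  | zero => exact Bool.false_ne_true
  | succ i =>
    intro h
    cases Sum.inl.inj h

theorem connected_replaceEdges {n : ℕ} (hn : 1 ≤ n) {X : TerminalGraph}
    (hX : X.source ≠ X.sink) (hc : X.graph.Connected) :
    (replaceEdges n X).graph.Connected := by
  have hplace : ∀ e v w, (replaceEdges n X).graph.Reachable (place X e v) (place X e w) := by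
    intro e v w
    obtain ⟨p⟩ := hc v w
    exact ⟨p.map ⟨place X e, fun {_ _} h => adj_place e h⟩⟩
  have hedge : ∀ e : BaseEdge n,
      (replaceEdges n X).graph.Reachable (.inl e.tail) (.inl e.head) := by
    intro e
    have := hplace e X.source X.sink
    rwa [place_source, place_sink hX] at this
  have hleft : ∀ (a j : Fin n) k, k ≤ n →
      (replaceEdges n X).graph.Reachable (.inl .s) (.inl (leftPath a j k)) := by
    intro a j k
    induction k with
    | zero => exact fun _ => .rfl
    | succ k ih => exact fun hk => (ih (by omega)).trans (hedge (.leftEdge a j ⟨k, hk⟩))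
  have hl : ∀ a, (replaceEdges n X).graph.Reachable (.inl .s) (.inl (.left a)) := fun a =>
    leftPath_last a a ▸ hleft a a n le_rfl
  have hright : ∀ (b j : Fin n) k, k ≤ n →
      (replaceEdges n X).graph.Reachable (.inl .s) (.inl (rightPath b j k)) := by
    intro b j k
    induction k with
    | zero => exact fun _ => (hl b).trans (hedge (.midEdge b b))
    | succ k ih => exact fun hk => (ih (by omega)).trans (hedge (.rightEdge b j ⟨k, hk⟩))
  have hbase : ∀ β, (replaceEdges n X).graph.Reachable (.inl .s) (.inl β) := by
    intro β
    cases β with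
    | s => exact .rfl
    | t => exact rightPath_last (⟨0, hn⟩ : Fin n) ⟨0, hn⟩ ▸ hright ⟨0, hn⟩ ⟨0, hn⟩ n le_rfl
    | left a => exact hl a
    | right b => exact hright b b 0 (Nat.zero_le _)
    | leftInner a j k => exact leftPath_succ_of_lt a j k ▸ hleft a j (k + 1) (by omega)
    | rightInner b j k => exact rightPath_succ_of_lt b j k ▸ hright b j (k + 1) (by omega)
  refine (SimpleGraph.connected_iff_exists_forall_reachable _).2 ⟨.inl .s, ?_⟩
  rintro (β | ⟨e, v⟩)
  · exact hbase β
  · have h := hplace e X.source v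
    rw [place_source, place_inner] at h
    exact (hbase _).trans h

theorem connected_recGraph {n : ℕ} (hn : 1 ≤ n) (i : ℕ) : (recGraph n i).graph.Connected := by
  induction i with
  | zero => exact (SimpleGraph.connected_top : (⊤ : SimpleGraph Bool).Connected)
  | succ i ih => exact connected_replaceEdges hn (source_ne_sink_recGraph n i) ih

instance finite_recGraph (n i : ℕ) : Finite (recGraph n i).V := by
  induction i with
  | zero => exact inferInstanceAs (Finite Bool)
  | succ i ih => exact inferInstanceAs (Finite (ReplacedVertex n (recGraph n i)))

/-- Each copy contributes its vertices other than the two terminals; the additive form avoids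
natural subtraction of terminals. -/
theorem card_replacedVertex (n : ℕ) {X : TerminalGraph} [Finite X.V] (hX : X.source ≠ X.sink) :
    Nat.card (ReplacedVertex n X) + 2 * (n ^ 2 * (2 * n + 1)) =
      2 + 2 * n + 2 * (n * n * (n - 1)) + n ^ 2 * (2 * n + 1) * Nat.card X.V := by
  have h : Nat.card {v : X.V // v ≠ X.source ∧ v ≠ X.sink} + 2 = Nat.card X.V := by
    have h1 := Set.ncard_add_ncard_compl ({X.source, X.sink} : Set X.V)
    rw [Set.ncard_pair hX] at h1
    have h2 : ({X.source, X.sink}ᶜ : Set X.V) = {v | v ≠ X.source ∧ v ≠ X.sink} := by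
      ext v
      simp
    rw [h2, ← Nat.card_coe_set_eq] at h1
    rw [← h1, add_comm]
    rfl
  rw [Nat.card_sum, Nat.card_prod, Nat.card_eq_fintype_card, Nat.card_eq_fintype_card,
    card_baseVertex, card_baseEdge, ← h]
  ring

theorem card_recGraph_succ (n i : ℕ) :
    Nat.card (recGraph n (i + 1)).V + 2 * (n ^ 2 * (2 * n + 1)) =
      2 + 2 * n + 2 * (n * n * (n - 1)) + n ^ 2 * (2 * n + 1) * Nat.card (recGraph n i).V :=
  card_replacedVertex n (source_ne_sink_recGraph n i)

theorem add_two_le_card_recGraph {n : ℕ} (hn : 1 ≤ n) (i : ℕ) :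
    i + 2 ≤ Nat.card (recGraph n i).V := by
  induction i with
  | zero => exact (show Nat.card Bool = 2 by simp).ge
  | succ i ih =>
    have h := card_recGraph_succ n i
    obtain ⟨c, hc⟩ := Nat.exists_eq_add_of_le ih
    rw [hc] at h
    have hm : 1 ≤ n ^ 2 * (2 * n + 1) := Nat.mul_pos (by positivity) (by omega)
    have := Nat.mul_le_mul_right (i + c) hm
    have h' : n ^ 2 * (2 * n + 1) * (i + 2 + c) =
      n ^ 2 * (2 * n + 1) * (i + c) + 2 * (n ^ 2 * (2 * n + 1)) := by ring
    omega

/-- The base graph has at most 6n³ vertices and 3n³ edges, and 6n³ + 3n³ = 9n³ absorbs both terms of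
the recursion. -/
theorem card_recGraph_le {n : ℕ} (hn : 1 ≤ n) (i : ℕ) :
    Nat.card (recGraph n i).V ≤ 2 * (9 * n ^ 3) ^ i := by
  induction i with
  | zero => exact (show Nat.card Bool = 2 by simp).le
  | succ i ih =>
    have h := card_recGraph_succ n i
    have hc := add_two_le_card_recGraph hn i
    have h1 : n ≤ n ^ 3 := Nat.le_self_pow (by norm_num) n
    have h2 : n ^ 2 ≤ n ^ 3 := Nat.pow_le_pow_right hn (by norm_num)
    have h3 : n * n * (n - 1) ≤ n ^ 3 := by
      rw [pow_succ, pow_two]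
      exact Nat.mul_le_mul_left _ (Nat.sub_le _ _)
    have h4 : n ^ 2 * (2 * n + 1) ≤ 3 * n ^ 3 := by
      have : n ^ 2 * (2 * n + 1) = 2 * n ^ 3 + n ^ 2 := by ring
      omega
    have h5 := Nat.mul_le_mul_right (Nat.card (recGraph n i).V) h4
    have h6 : 6 * n ^ 3 ≤ 6 * n ^ 3 * Nat.card (recGraph n i).V :=
      Nat.le_mul_of_pos_right _ (by omega)
    calc Nat.card (recGraph n (i + 1)).V
        ≤ 6 * n ^ 3 + 3 * n ^ 3 * Nat.card (recGraph n i).V := by omega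
      _ ≤ 9 * n ^ 3 * Nat.card (recGraph n i).V := by
        have : 9 * n ^ 3 * Nat.card (recGraph n i).V = 6 * n ^ 3 * Nat.card (recGraph n i).V +
          3 * n ^ 3 * Nat.card (recGraph n i).V := by ring
        omega
      _ ≤ 9 * n ^ 3 * (2 * (9 * n ^ 3) ^ i) := Nat.mul_le_mul_left _ ih
      _ = 2 * (9 * n ^ 3) ^ (i + 1) := by ring

/-- The height function of the recursive graphs. -/
noncomputable def recHeight (n : ℕ) : (i : ℕ) → (recGraph n i).V → ℕ
  | 0 => fun b : Bool => if b then 1 else 0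
  | i + 1 => replacedHeight ((2 * n + 1) ^ i) (recHeight n i)

theorem isHeight_recHeight (n i : ℕ) :
    IsHeight (recGraph n i) ((2 * n + 1) ^ i) (recHeight n i) := by
  induction i with
  | zero =>
    refine ⟨rfl, rfl, fun (a b : Bool) _ => ?_⟩
    simp only [recHeight]
    split_ifs <;> omega
  | succ i ih =>
    rw [pow_succ']
    exact ih.replaceEdges

/-! ### Sums over the edges of the recursive graphs -/

/-- The sum of `g` over the edges of the recursive graph, directed towards the sink. -/
noncomputable def edgeSum (n : ℕ) :
    (i : ℕ) → ((recGraph n i).V → (recGraph n i).V → ℝ≥0∞) → ℝ≥0∞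
  | 0, g => g false true
  | i + 1, g => ∑ e : BaseEdge n, edgeSum n i fun x y =>
      g (place (recGraph n i) e x) (place (recGraph n i) e y)

theorem edgeSum_mono {n : ℕ} : ∀ {i : ℕ} {g g' : (recGraph n i).V → (recGraph n i).V → ℝ≥0∞},
    (∀ x y, g x y ≤ g' x y) → edgeSum n i g ≤ edgeSum n i g'
  | 0, _, _, h => h _ _
  | _ + 1, _, _, h => Finset.sum_le_sum fun _ _ => edgeSum_mono fun _ _ => h _ _

theorem edgeSum_const_mul {n : ℕ} (c : ℝ≥0∞) :
    ∀ {i : ℕ} (g : (recGraph n i).V → (recGraph n i).V → ℝ≥0∞),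
      edgeSum n i (fun x y => c * g x y) = c * edgeSum n i g
  | 0, _ => rfl
  | i + 1, g => by
    simp only [edgeSum, Finset.mul_sum]
    exact Finset.sum_congr rfl fun e _ => edgeSum_const_mul c _

theorem edgeSum_finset_sum {n : ℕ} {ι : Type*} (s : Finset ι) :
    ∀ {i : ℕ} (g : ι → (recGraph n i).V → (recGraph n i).V → ℝ≥0∞),
      edgeSum n i (fun x y => ∑ j ∈ s, g j x y) = ∑ j ∈ s, edgeSum n i (g j)
  | 0, _ => rfl
  | i + 1, g => by
    simp only [edgeSum]
    rw [Finset.sum_comm]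
    exact Finset.sum_congr rfl fun e _ => edgeSum_finset_sum s _

theorem aemeasurable_edgeSum {n : ℕ} {Ω : Type*} [MeasurableSpace Ω]
    {μ : MeasureTheory.Measure Ω} :
    ∀ {i : ℕ} {g : Ω → (recGraph n i).V → (recGraph n i).V → ℝ≥0∞},
      (∀ x y, AEMeasurable (fun ω => g ω x y) μ) → AEMeasurable (fun ω => edgeSum n i (g ω)) μ
  | 0, _, h => h _ _
  | _ + 1, _, h => Finset.aemeasurable_fun_sum _ fun _ _ =>
      aemeasurable_edgeSum fun _ _ => h _ _

/-- The sum has m^i terms, m = n²(2n + 1), all at adjacent pairs because `place` preserves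
adjacency; measurability lets the integral pass through it. -/
theorem lintegral_edgeSum_le {n : ℕ} {Ω : Type*} [MeasurableSpace Ω]
    {μ : MeasureTheory.Measure Ω} {c : ℝ≥0∞} :
    ∀ {i : ℕ} {g : Ω → (recGraph n i).V → (recGraph n i).V → ℝ≥0∞},
      (∀ x y, AEMeasurable (fun ω => g ω x y) μ) →
      (∀ x y, (recGraph n i).graph.Adj x y → ∫⁻ ω, g ω x y ∂μ ≤ c) →
      ∫⁻ ω, edgeSum n i (g ω) ∂μ ≤ ((n ^ 2 * (2 * n + 1) : ℕ) : ℝ≥0∞) ^ i * c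
  | 0, _, _, h => by
    rw [pow_zero, one_mul]
    exact h _ _ Bool.false_ne_true
  | i + 1, g, hg, h => by
    simp only [edgeSum]
    refine (MeasureTheory.lintegral_finsetSum' _ (f := fun e ω => edgeSum n i fun x y =>
      g ω (place (recGraph n i) e x) (place (recGraph n i) e y))
      fun e _ => aemeasurable_edgeSum fun _ _ => hg _ _).le.trans ?_
    refine (Finset.sum_le_card_nsmul _ _ _ fun e _ => lintegral_edgeSum_le (fun _ _ => hg _ _)
      fun x y hxy => h _ _ (adj_place e hxy)).trans ?_
    rw [Finset.card_univ, card_baseEdge, nsmul_eq_mul, ← mul_assoc, ← pow_succ']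

/-- If no climb from the source to the sink has the property `P`, then at least `n ^ (2 * i)` edges
do not have it. -/
theorem le_edgeSum_of_not_hasClimb {n : ℕ} : ∀ {i : ℕ}
    {P : (recGraph n i).V → (recGraph n i).V → Prop} [∀ x y, Decidable (P x y)],
    ¬ HasClimb (recGraph n i) ((2 * n + 1) ^ i) (recHeight n i) P →
    ((n ^ 2 : ℕ) : ℝ≥0∞) ^ i ≤ edgeSum n i fun x y => if P x y then 0 else 1
  | 0, P, _, h => by
    have hP : ¬ P false true := fun hP => h
      ⟨fun k => show Bool from decide (k ≠ 0), rfl, rfl, fun k hk => by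
        rw [pow_zero] at hk
        interval_cases k <;> rfl, fun k hk => by
        rw [pow_zero, Nat.lt_one_iff] at hk
        subst hk
        exact hP⟩
    rw [pow_zero, edgeSum, if_neg hP]
  | i + 1, P, hdec, h => by
    -- Each of the n² base paths has a copy without a climb, since otherwise its climbs would
    -- combine; edge-disjointness makes these copies distinct.
    have key : ∀ ab : Fin n × Fin n, ∃ q, ¬ HasClimb (recGraph n i) ((2 * n + 1) ^ i)
        (recHeight n i) fun x y => P (place (recGraph n i) (basePathEdge ab.1 ab.2 q) x)
          (place (recGraph n i) (basePathEdge ab.1 ab.2 q) y) := by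
      intro ab
      by_contra! hq
      refine h ?_
      rw [pow_succ']
      exact HasClimb.replaceEdges (source_ne_sink_recGraph n i) (isHeight_recHeight n i)
        (by positivity) ab.1 ab.2 fun q _ => hq q
    choose q hq using key
    have := Classical.decEq (BaseEdge n)
    let f : Fin n × Fin n → BaseEdge n := fun ab => basePathEdge ab.1 ab.2 (q ab)
    have hf : Function.Injective f := fun ab ab' hab => by
      have := congrArg (fun e => (baseEdgeEquiv n e).1) hab
      simpa only [f, baseEdgeEquiv_basePathEdge] using this
    simp only [edgeSum]
    refine le_trans ?_ (Finset.sum_le_sum_of_subset (Finset.subset_univ (Finset.univ.image f)))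
    rw [Finset.sum_image fun _ _ _ _ hab => hf hab]
    refine le_trans ?_ (Finset.card_nsmul_le_sum _ _ _ fun ab _ =>
      letI : ∀ x y, Decidable (P (place (recGraph n i) (f ab) x) (place (recGraph n i) (f ab) y)) :=
        fun x y => hdec _ _
      le_edgeSum_of_not_hasClimb (hq ab))
    rw [Finset.card_univ, Fintype.card_prod, Fintype.card_fin, nsmul_eq_mul, pow_succ', ← pow_two]

/-! ### Counting stretched edges over all scales -/

section Stretch

variable {n : ℕ} {W : Type*} {G : SimpleGraph W} {ℓ : Sym2 W → ℝ≥0}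

/-- In a target without a complete minor, many edges are stretched at each scale. -/
theorem le_edgeSum_stretched (hG : ¬ IsGraphMinor (⊤ : SimpleGraph (Fin n)) G) {l : ℕ} :
    ∀ {i : ℕ}, l < i → ∀ {Φ : (recGraph n i).V → W},
    (∀ x y, pathDist (recGraph n i).graph x y ≤ weightedDist G ℓ (Φ x) (Φ y)) →
    ((n ^ 2 : ℕ) : ℝ≥0∞) ^ l * ((n ^ 2 * (2 * n + 1) : ℕ) : ℝ≥0∞) ^ (i - l - 1) ≤
      edgeSum n i fun x y => if weightedDist G ℓ (Φ x) (Φ y) <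
        (((((2 * n + 1) ^ l : ℕ) : ℝ≥0) / 8 : ℝ≥0) : ℝ≥0∞) then 0 else 1
  | 0, hl, _, _ => by omega
  | i + 1, hl, Φ, hΦ => by
    simp only [edgeSum]
    rcases (Nat.lt_succ_iff.1 hl).lt_or_eq with hl' | rfl
    -- Above scale l + 1, restrict the embedding to each copy: domination survives because distances
    -- within a copy are not shortened.
    · have ih : ∀ e : BaseEdge n, _ := fun e =>
        le_edgeSum_stretched hG hl' (Φ := fun x => Φ (place (recGraph n i) e x))
          fun x y => (pathDist_le_pathDist_place e x y).trans (hΦ _ _)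
      refine le_trans ?_ (Finset.card_nsmul_le_sum _ _ _ fun e _ => ih e)
      rw [Finset.card_univ, card_baseEdge, nsmul_eq_mul, mul_left_comm, ← pow_succ',
        show i - l - 1 + 1 = i + 1 - l - 1 by omega]
    -- At depth l + 1, climbs in all copies would give the excluded minor, so one copy supplies the
    -- stretched edges.
    · have : ∃ e : BaseEdge n, ¬ HasClimb (recGraph n l) ((2 * n + 1) ^ l) (recHeight n l)
          fun x y => weightedDist G ℓ (Φ (place (recGraph n l) e x))
            (Φ (place (recGraph n l) e y)) <
              (((((2 * n + 1) ^ l : ℕ) : ℝ≥0) / 8 : ℝ≥0) : ℝ≥0∞) := by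
        by_contra! h
        exact hG (isGraphMinor_top_of_hasClimb (source_ne_sink_recGraph n l)
          (isHeight_recHeight n l) (by positivity) hΦ h)
      obtain ⟨e, he⟩ := this
      rw [show l + 1 - l - 1 = 0 by omega, pow_zero, mul_one]
      exact (le_edgeSum_of_not_hasClimb he).trans
        (Finset.single_le_sum (f := fun e : BaseEdge n => edgeSum n l fun x y =>
          if weightedDist G ℓ (Φ (place (recGraph n l) e x)) (Φ (place (recGraph n l) e y)) <
            (((((2 * n + 1) ^ l : ℕ) : ℝ≥0) / 8 : ℝ≥0) : ℝ≥0∞) then 0 else 1)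
          (fun _ _ => zero_le) (Finset.mem_univ e))

/-- The ratio m/(m - 1) of the geometric sum to its last term is at most 3/2 for m ≥ 3. -/
theorem two_mul_sum_pow_le {m : ℕ} (hm : 3 ≤ m) (i : ℕ) :
    2 * ∑ l ∈ Finset.range (i + 1), m ^ l ≤ 3 * m ^ i := by
  induction i with
  | zero => simp
  | succ i ih =>
    rw [Finset.sum_range_succ, pow_succ' m i]
    have := Nat.mul_le_mul_right (m ^ i) hm
    omega

/-- A number dominates the geometric sum of the scales below it. -/
theorem sum_scales_le {m : ℕ} (hm : 3 ≤ m) (x : ℝ≥0∞) (i : ℕ) :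
    ∑ l ∈ Finset.range i, ((m ^ l : ℕ) : ℝ≥0∞) *
      (if x < ((((m ^ l : ℕ) : ℝ≥0) / 8 : ℝ≥0) : ℝ≥0∞) then 0 else 1) ≤ 12 * x := by
  induction i with
  | zero => simp
  | succ i ih =>
    by_cases h : x < ((((m ^ i : ℕ) : ℝ≥0) / 8 : ℝ≥0) : ℝ≥0∞)
    · rw [Finset.sum_range_succ, if_pos h, mul_zero, add_zero]
      exact ih
    -- Here m^i ≤ 8x, so all smaller scales together cost at most (3/2) · 8x = 12x.
    · have h1 : ((∑ l ∈ Finset.range (i + 1), m ^ l : ℕ) : ℝ≥0) ≤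
          12 * (((m ^ i : ℕ) : ℝ≥0) / 8) := by
        have : (2 * (∑ l ∈ Finset.range (i + 1), m ^ l : ℕ) : ℝ) ≤ 3 * ((m ^ i : ℕ) : ℝ) := by
          exact_mod_cast two_mul_sum_pow_le hm i
        rw [← NNReal.coe_le_coe]
        push_cast at this ⊢
        linarith
      calc _ ≤ ∑ l ∈ Finset.range (i + 1), ((m ^ l : ℕ) : ℝ≥0∞) := by
            refine Finset.sum_le_sum fun l _ => ?_
            split_ifs <;> simp
        _ = (((∑ l ∈ Finset.range (i + 1), m ^ l : ℕ) : ℝ≥0) : ℝ≥0∞) := by push_cast; rfl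
        _ ≤ ((12 * (((m ^ i : ℕ) : ℝ≥0) / 8) : ℝ≥0) : ℝ≥0∞) := ENNReal.coe_le_coe.2 h1
        _ = 12 * ((((m ^ i : ℕ) : ℝ≥0) / 8 : ℝ≥0) : ℝ≥0∞) := by rw [ENNReal.coe_mul]; rfl
        _ ≤ 12 * x := by gcongr; exact not_lt.1 h

/-- The average stretch of the edges of the recursive graph grows linearly with the depth. -/
theorem mul_pow_le_edgeSum (hn : 1 ≤ n) (hG : ¬ IsGraphMinor (⊤ : SimpleGraph (Fin n)) G) {i : ℕ}
    {Φ : (recGraph n i).V → W}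
    (hΦ : ∀ x y, pathDist (recGraph n i).graph x y ≤ weightedDist G ℓ (Φ x) (Φ y)) :
    (i : ℝ≥0∞) * ((n ^ 2 * (2 * n + 1) : ℕ) : ℝ≥0∞) ^ (i - 1) ≤
      12 * edgeSum n i fun x y => weightedDist G ℓ (Φ x) (Φ y) := by
  classical
  rw [← edgeSum_const_mul]
  refine le_trans ?_ (edgeSum_mono fun x y => sum_scales_le (m := 2 * n + 1) (by omega) _ i)
  rw [edgeSum_finset_sum]
  -- All scales contribute equally: (2n + 1)^l times n^(2l) is the l-th power of n²(2n + 1).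
  have key : ∀ l ∈ Finset.range i, ((n ^ 2 * (2 * n + 1) : ℕ) : ℝ≥0∞) ^ (i - 1) ≤
      edgeSum n i fun x y => (((2 * n + 1) ^ l : ℕ) : ℝ≥0∞) *
        if weightedDist G ℓ (Φ x) (Φ y) < (((((2 * n + 1) ^ l : ℕ) : ℝ≥0) / 8 : ℝ≥0) : ℝ≥0∞)
          then 0 else 1 := by
    intro l hl
    rw [Finset.mem_range] at hl
    rw [edgeSum_const_mul]
    refine le_trans (le_of_eq ?_) (mul_le_mul_right (le_edgeSum_stretched hG hl hΦ) _)
    rw [show i - 1 = l + (i - l - 1) by omega, pow_add, Nat.cast_mul (n ^ 2),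
      mul_pow _ _ l, Nat.cast_pow (2 * n + 1), mul_assoc, mul_left_comm]
  refine le_trans (le_of_eq ?_) (Finset.card_nsmul_le_sum _ _ _ key)
  rw [Finset.card_range, nsmul_eq_mul]

end Stretch

/-! ### The lower bound -/

/-- An approximating distribution has expected stretch at least one. -/
theorem one_le_of_approximates {V Ω : Type*} [MeasurableSpace Ω] {F : Set FinGraph}
    {H : SimpleGraph V} (μ : MeasureTheory.Measure Ω) [MeasureTheory.IsProbabilityMeasure μ]
    {Φ : Ω → DominatingEmbedding F H} {α : ℝ≥0} (h : ApproximatesInExpectation μ Φ α)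
    (hH : H.Connected) {x y : V} (hxy : x ≠ y) : 1 ≤ α := by
  have h1 : pathDist H x y ≤ α * pathDist H x y :=
    calc pathDist H x y = ∫⁻ _, pathDist H x y ∂μ := by simp
      _ ≤ ∫⁻ ω, (Φ ω).dist x y ∂μ := MeasureTheory.lintegral_mono fun ω => (Φ ω).dominates x y
      _ ≤ α * pathDist H x y := h.expectation_le x y
  obtain ⟨p, hp⟩ := hH.exists_walk_length_eq_edist x y
  have h2 : pathDist H x y = ((p.length : ℝ≥0) : ℝ≥0∞) := by
    rw [pathDist, ← hp]
    simp
  have h3 : 0 < p.length := by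
    refine Nat.pos_of_ne_zero fun h0 => hxy ?_
    exact SimpleGraph.Walk.eq_of_length_eq_zero h0
  rw [h2, ← ENNReal.coe_mul, ENNReal.coe_le_coe] at h1
  have h4 : (0 : ℝ≥0) < p.length := by exact_mod_cast h3
  exact le_of_mul_le_mul_right (by rwa [one_mul]) h4

/-- The approximation factor grows linearly with the depth of the recursive graph. -/
theorem depth_le_of_approximates {n : ℕ} (hn : 1 ≤ n) {F : Set FinGraph} {M : FinGraph}
    (hF : MinorClosed F) (hM : M ∉ F) (hcard : Nat.card M.V = n) {i : ℕ} {Ω : Type*}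
    [MeasurableSpace Ω] (μ : MeasureTheory.Measure Ω) [MeasureTheory.IsProbabilityMeasure μ]
    {Φ : Ω → DominatingEmbedding F (recGraph n i).graph} {α : ℝ≥0}
    (h : ApproximatesInExpectation μ Φ α) :
    (i : ℝ) ≤ 12 * (α * (n ^ 2 * (2 * n + 1) : ℕ)) := by
  have hfree : ∀ ω, ¬ IsGraphMinor (⊤ : SimpleGraph (Fin n)) (Φ ω).target.graph := by
    intro ω hω
    have := M.finite
    exact hM (hF _ (Φ ω).target_mem M (hω.of_top (Finite.equivFinOfCardEq hcard)))
  rcases i with _ | i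
  · push_cast
    positivity
  have h1 : ((i + 1 : ℕ) : ℝ≥0∞) * ((n ^ 2 * (2 * n + 1) : ℕ) : ℝ≥0∞) ^ i ≤
      12 * (((n ^ 2 * (2 * n + 1) : ℕ) : ℝ≥0∞) ^ (i + 1) * α) :=
    calc _ = ∫⁻ _, ((i + 1 : ℕ) : ℝ≥0∞) * ((n ^ 2 * (2 * n + 1) : ℕ) : ℝ≥0∞) ^ i ∂μ := by simp
      _ ≤ ∫⁻ ω, 12 * edgeSum n (i + 1) (Φ ω).dist ∂μ :=
        MeasureTheory.lintegral_mono fun ω => mul_pow_le_edgeSum hn (hfree ω) (Φ ω).dominates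
      _ = 12 * ∫⁻ ω, edgeSum n (i + 1) (Φ ω).dist ∂μ :=
        MeasureTheory.lintegral_const_mul'' _ (aemeasurable_edgeSum h.aemeasurable)
      _ ≤ _ := by
        gcongr
        refine lintegral_edgeSum_le h.aemeasurable fun x y hxy => ?_
        refine (h.expectation_le x y).trans ?_
        have : pathDist (recGraph n (i + 1)).graph x y ≤ 1 := by
          have := ENat.toENNReal_le.2 hxy.toWalk.edist_le
          simpa [pathDist] using this
        calc (α : ℝ≥0∞) * pathDist (recGraph n (i + 1)).graph x y ≤ α * 1 := by gcongr
          _ = α := mul_one _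
  -- Every term is finite; in `ℝ≥0` the common power can be cancelled.
  have h2 : ((i + 1 : ℕ) : ℝ≥0) * ((n ^ 2 * (2 * n + 1) : ℕ) : ℝ≥0) ^ i ≤
      12 * (((n ^ 2 * (2 * n + 1) : ℕ) : ℝ≥0) ^ (i + 1) * α) := by
    exact_mod_cast h1
  have hm : (0 : ℝ≥0) < ((n ^ 2 * (2 * n + 1) : ℕ) : ℝ≥0) ^ i := by
    have : 0 < n ^ 2 * (2 * n + 1) := by positivity
    exact pow_pos (by exact_mod_cast this) i
  have h3 : ((i + 1 : ℕ) : ℝ≥0) ≤ 12 * (α * ((n ^ 2 * (2 * n + 1) : ℕ) : ℝ≥0)) := by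
    refine le_of_mul_le_mul_right (h2.trans (le_of_eq ?_)) hm
    rw [pow_succ]
    ring
  exact_mod_cast h3

/-- The crude bound log x ≤ x for x = 9n³ only costs a power of n. -/
theorem log_card_recGraph_le {n : ℕ} (hn : 1 ≤ n) (i : ℕ) :
    Real.log (Nat.card (recGraph n i).V) ≤ 1 + i * (9 * (n : ℝ) ^ 3) := by
  have hpos : (0 : ℝ) < Nat.card (recGraph n i).V := by
    have := add_two_le_card_recGraph hn i
    exact_mod_cast (by omega : 0 < Nat.card (recGraph n i).V)
  have hn' : (0 : ℝ) < n := by exact_mod_cast hn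
  have h9 : (0 : ℝ) < 9 * (n : ℝ) ^ 3 := by positivity
  have hle : (Nat.card (recGraph n i).V : ℝ) ≤ 2 * (9 * (n : ℝ) ^ 3) ^ i := by
    exact_mod_cast card_recGraph_le hn i
  calc Real.log (Nat.card (recGraph n i).V)
      ≤ Real.log (2 * (9 * (n : ℝ) ^ 3) ^ i) := Real.log_le_log hpos hle
    _ = Real.log 2 + i * Real.log (9 * (n : ℝ) ^ 3) := by
      rw [Real.log_mul (by norm_num) (pow_pos h9 i).ne', Real.log_pow]
    _ ≤ 1 + i * (9 * (n : ℝ) ^ 3) := by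
      have h1 : Real.log 2 ≤ 1 := by linarith [Real.log_two_lt_d9]
      have h2 := Real.log_le_self h9.le
      gcongr

theorem theorem1 :
    ∃ (c : ℝ) (d : ℕ), 0 < c ∧ ∀ n : ℕ, 1 ≤ n →
      (∀ i : ℕ, Finite (recGraph n i).V ∧ (recGraph n i).graph.Connected ∧
        treewidth (recGraph n i).graph ≤ ((n + 1 : ℕ) : ℕ∞)) ∧
      Filter.Tendsto (fun i : ℕ => Nat.card (recGraph n i).V) Filter.atTop Filter.atTop ∧
      ∀ (F : Set FinGraph) (M : FinGraph), MinorClosed F → M ∉ F → Nat.card M.V = n →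
        ∀ (i : ℕ) (Ω : Type*) [MeasurableSpace Ω] (μ : MeasureTheory.Measure Ω)
          [MeasureTheory.IsProbabilityMeasure μ]
          (Φ : Ω → DominatingEmbedding F (recGraph n i).graph) (α : ℝ≥0),
          ApproximatesInExpectation μ Φ α →
            c * Real.log (Nat.card (recGraph n i).V) / (n : ℝ) ^ d ≤ (α : ℝ) := by
  -- Depth i ≤ 12 · 3 α n³, times 9n³ from the logarithm, gives 324 α n⁶; the additive 1 is absorbed
  -- by α ≥ 1, whence 325.
  refine ⟨1 / 325, 6, by norm_num, fun n hn => ⟨fun i => ⟨finite_recGraph n i,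
    connected_recGraph hn i, treewidth_recGraph_le hn i⟩, ?_, ?_⟩⟩
  · exact Filter.tendsto_atTop_mono
      (fun i => (Nat.le_add_right i 2).trans (add_two_le_card_recGraph hn i)) Filter.tendsto_id
  · intro F M hF hM hcard i Ω _ μ _ Φ α h
    have hα : (1 : ℝ) ≤ α := by
      exact_mod_cast one_le_of_approximates μ h (connected_recGraph hn i)
        (source_ne_sink_recGraph n i)
    have hi := depth_le_of_approximates hn hF hM hcard μ h
    have hlog := log_card_recGraph_le hn i
    have hn' : (1 : ℝ) ≤ n := by exact_mod_cast hn
    have h23 : (n : ℝ) ^ 2 ≤ (n : ℝ) ^ 3 := pow_le_pow_right₀ hn' (by norm_num)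
    have h6 : (1 : ℝ) ≤ (n : ℝ) ^ 6 := one_le_pow₀ hn'
    have hi' : (i : ℝ) ≤ 36 * α * (n : ℝ) ^ 3 := by
      refine hi.trans ?_
      have : ((n ^ 2 * (2 * n + 1) : ℕ) : ℝ) ≤ 3 * (n : ℝ) ^ 3 := by
        push_cast
        nlinarith
      nlinarith
    have h1 : (i : ℝ) * (9 * (n : ℝ) ^ 3) ≤ 324 * (α * (n : ℝ) ^ 6) := by
      have := mul_le_mul_of_nonneg_right hi' (show (0 : ℝ) ≤ 9 * (n : ℝ) ^ 3 by positivity)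
      refine this.trans (le_of_eq ?_)
      ring
    have h2 : (1 : ℝ) ≤ α * (n : ℝ) ^ 6 := one_le_mul_of_one_le_of_one_le hα h6
    rw [div_le_iff₀ (by linarith)]
    linarith
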